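/- Write $[n]=\{1,\dots,n\}$. There is a function $f:\mathbb N\to\mathbb N$, $k\mapsto f_k$, with $f_k=O(2^{k/2})$, such that the following holds for every $n,k$ and every symmetric $n\times n$ matrix $A=(A_{ij})$ with entries in $\{0,1\}$, zero diagonal and (real) rank $k$. (1) The rows of $A$ can be partitioned into at most $f_k$ classes such that any two rows in the same class are identical. (2) Let $P_1,\dots,P_K$ be any partition of $[n]$ (empty classes allowed; in particular $K=f_k$ as in (1)) such that the rows of $A$ in the same class are identical. Let $\mathcal P(i)$ be the index of the class of $i$, and let $\tilde a_{st}=1$ if $A_{im}=1$ for all $i\in P_s$, $m\in P_t$, and $\tilde a_{st}=0$ otherwise. Let $a_1,\dots,a_n\ge 0$, $\ell_n\ge 0$, $i_0\in[n]$ and $B=\operatorname{diag}(a_1,\dots,a_n)\,A\,\operatorname{diag}(a_1,\dots,a_n)$. Consider - the marked $K$-type branching process $\mathsf{MBP}_K(i_0)$: the root has mark $i_0$; a particle with mark $i$ has, independently for $j\in[K]$, $\mathrm{Poi}\bigl(\ell_n a_i\tilde a_{\mathcal P(i)j}\sum_{m\in P_j}a_m\bigr)$ children of type $j$; each child of type $j$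 independently receives the mark $m\in P_j$ with probability $a_m/\sum_{m'\in P_j}a_{m'}$ (if this sum is $0$, there are no children of type $j$); - the $n$-type branching process $\mathsf{BP}(i_0)$ of $B$: the root has type $i_0$; a particle of type $i$ has, independently for $j\in[n]$, $\mathrm{Poi}(\ell_n B_{ij})$ children of type $j$. In both processes different particles reproduce independently. Then $\mathsf{MBP}_K(i_0)$, with every particle labelled by its mark, has the same distribution as $\mathsf{BP}(i_0)$, with every particle labelled by its type; that is, the random labelled family trees (rooted trees with unordered siblings, observed through their first $l$ generations for all $l$ jointly) have the same law. -/

import Mathlib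

open MeasureTheory ProbabilityTheory
open scoped NNReal ENNReal

noncomputable section

namespace RankOneKL

/-- Isomorphism classes of rooted trees of height at most `l` (the first `l` generations of a
family tree) whose vertices carry labels in `α`; siblings are not ordered. -/
def LabelledTree (α : Type) : ℕ → Type
  | 0 => α
  | l + 1 => α × Multiset (LabelledTree α l)

instance instCountableLabelledTree (α : Type) [Countable α] :
    ∀ l, Countable (LabelledTree α l)
  | 0 => inferInstanceAs (Countable α)
  | l + 1 =>
    haveI := instCountableLabelledTree α l
    inferInstanceAs (Countable (α × Multiset (LabelledTree α l)))

instance instMeasurableSpaceLabelledTree (α : Type) (l : ℕ) :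
    MeasurableSpace (LabelledTree α l) := ⊤

instance instDiscreteLabelledTree (α : Type) (l : ℕ) :
    DiscreteMeasurableSpace (LabelledTree α l) := ⟨fun _ => trivial⟩

/-- The randomness attached to one potential particle of a branching process with marks `Fin n`
and types `Fin K`: the first component at `(i, t)` is the number of type-`t` children the particle
has in case its mark is `i`; the second component at `t` is the mark the particle receives in
case its type is `t`. -/
abbrev Noise (n K : ℕ) : Type := (Fin n → Fin K → ℕ) × (Fin K → Fin n)

/-- All these variables are independent; the numbers of children are Poisson with mean
`rate i t`, and a type-`t` particle receives a mark with law `mark t`. -/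
def noiseLaw {n K : ℕ} (rate : Fin n → Fin K → ℝ≥0) (mark : Fin K → PMF (Fin n)) :
    Measure (Noise n K) :=
  (Measure.pi fun i => Measure.pi fun t => poissonMeasure (rate i t)).prod
    (Measure.pi fun t => (mark t).toMeasure)

instance instProbNoiseLaw {n K : ℕ} (rate : Fin n → Fin K → ℝ≥0) (mark : Fin K → PMF (Fin n)) :
    IsProbabilityMeasure (noiseLaw rate mark) := by
  unfold noiseLaw; infer_instance

/-- The family tree up to generation `l` of a particle with mark `i`, each particle being labelled
by its mark. Potential descendants are indexed by words: the letter `(t, r)` leads to the `r`-th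
child of type `t`, which is present if and only if `r` is less than the number of type-`t`
children. -/
def familyTree {n K : ℕ} :
    (l : ℕ) → Fin n → (List (Fin K × ℕ) → Noise n K) → LabelledTree (Fin n) l
  | 0, i, _ => i
  | l + 1, i, ω =>
    (i, ∑ t : Fin K, ∑ r ∈ Finset.range ((ω []).1 i t),
      ({familyTree l ((ω [(t, r)]).2 t) fun w => ω ((t, r) :: w)} :
        Multiset (LabelledTree (Fin n) l)))

theorem measurable_familyTree {n K : ℕ} (l : ℕ) :
    ∀ i : Fin n, Measurable (familyTree (K := K) l i) := by
  induction l with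
  | zero => intro i; exact measurable_const
  | succ l ih =>
    intro i
    let _ : MeasurableSpace (Multiset (LabelledTree (Fin n) l)) := ⊤
    have : DiscreteMeasurableSpace (Multiset (LabelledTree (Fin n) l)) := ⟨fun _ => trivial⟩
    have hadd : MeasurableAdd₂ (Multiset (LabelledTree (Fin n) l)) := ⟨.of_discrete⟩
    let root : Multiset (LabelledTree (Fin n) l) → LabelledTree (Fin n) (l + 1) := fun s => (i, s)
    have hroot : Measurable root := .of_discrete
    refine hroot.comp (Finset.measurable_sum _ fun t _ => ?_)
    have hsub : ∀ r : ℕ, Measurable fun ω : List (Fin K × ℕ) → Noise n K =>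
        ({familyTree l ((ω [(t, r)]).2 t) fun w => ω ((t, r) :: w)} :
          Multiset (LabelledTree (Fin n) l)) := by
      intro r
      have hm : Measurable fun ω : List (Fin K × ℕ) → Noise n K => (ω [(t, r)]).2 t := by fun_prop
      have hs : Measurable fun (ω : List (Fin K × ℕ) → Noise n K) (w : List (Fin K × ℕ)) =>
          ω ((t, r) :: w) := by fun_prop
      have hj : Measurable fun p : (List (Fin K × ℕ) → Noise n K) × Fin n =>
          familyTree l p.2 p.1 := measurable_from_prod_countable_left ih
      have hsing : Measurable fun x : LabelledTree (Fin n) l =>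
          ({x} : Multiset (LabelledTree (Fin n) l)) := .of_discrete
      exact hsing.comp (hj.comp (hs.prodMk hm))
    have hN : Measurable fun ω : List (Fin K × ℕ) → Noise n K => (ω []).1 i t := by fun_prop
    have hsum : Measurable fun p : (List (Fin K × ℕ) → Noise n K) × ℕ =>
        ∑ r ∈ Finset.range p.2,
          ({familyTree l ((p.1 [(t, r)]).2 t) fun w => p.1 ((t, r) :: w)} :
            Multiset (LabelledTree (Fin n) l)) :=
      measurable_from_prod_countable_left fun N =>
        Finset.measurable_sum (Finset.range N) fun r _ => hsub r
    exact hsum.comp (measurable_id.prodMk hN)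

/-- The law of the marked `K`-type branching process started from a particle with mark `i₀`: the
joint law of the mark-labelled family trees up to generation `l`, for all `l`. Independently of
everything else, a particle with mark `i` has a Poisson number with mean `rate i t` of children of
each type `t`, and each child of type `t` receives a mark with law `mark t`. -/
def markedBPLaw {n K : ℕ} (rate : Fin n → Fin K → ℝ≥0) (mark : Fin K → PMF (Fin n))
    (i₀ : Fin n) : Measure ((l : ℕ) → LabelledTree (Fin n) l) :=
  (Measure.infinitePi fun _ : List (Fin K × ℕ) => noiseLaw rate mark).map
    fun ω l => familyTree l i₀ ω

instance instProbMarkedBPLaw {n K : ℕ} (rate : Fin n → Fin K → ℝ≥0)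
    (mark : Fin K → PMF (Fin n)) (i₀ : Fin n) :
    IsProbabilityMeasure (markedBPLaw rate mark i₀) :=
  Measure.isProbabilityMeasure_map
    (measurable_pi_lambda _ fun l => measurable_familyTree l i₀).aemeasurable

/-- The law of the `n`-type branching process of a non-negative matrix `B`: marks and types are the
same, and a particle of type `i` has a Poisson number of children of type `j` with mean
`ℓ * B i j`. -/
def nTypeBPLaw {n : ℕ} (ℓ : ℝ) (B : Matrix (Fin n) (Fin n) ℝ) (i₀ : Fin n) :
    Measure ((l : ℕ) → LabelledTree (Fin n) l) :=
  markedBPLaw (fun i j => (ℓ * B i j).toNNReal) PMF.pure i₀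

/-- `P` sorts the rows of `A` into classes `P ⁻¹' {1}, …, P ⁻¹' {K}` (some of which may be empty)
such that rows in the same class are identical. -/
def IsCanonicalPartition {n K : ℕ} (A : Matrix (Fin n) (Fin n) ℝ) (P : Fin n → Fin K) : Prop :=
  ∀ i j, P i = P j → ∀ m, A i m = A j m

open Classical in
/-- The proxy adjacency matrix: `1` if all edges between the two classes are present,
else `0`. -/
def proxy {n K : ℕ} (A : Matrix (Fin n) (Fin n) ℝ) (P : Fin n → Fin K) :
    Matrix (Fin K) (Fin K) ℝ :=
  fun s t => if ∀ i m, P i = s → P m = t → A i m = 1 then 1 else 0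

/-- The total weight of the class `t`. -/
def classWeight {n K : ℕ} (a : Fin n → ℝ) (P : Fin n → Fin K) (t : Fin K) : ℝ :=
  ∑ m with P m = t, a m

/-- The weight of the mark `m` for a particle of type `t`. -/
def markWeight {n K : ℕ} (a : Fin n → ℝ) (P : Fin n → Fin K) (t : Fin K) (m : Fin n) : ℝ≥0∞ :=
  if P m = t then ENNReal.ofReal (a m) else 0

theorem tsum_markWeight_ne_top {n K : ℕ} (a : Fin n → ℝ) (P : Fin n → Fin K) (t : Fin K) :
    ∑' m, markWeight a P t m ≠ ∞ := by
  rw [tsum_fintype, ENNReal.sum_ne_top]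
  intro m _
  unfold markWeight
  split_ifs <;> simp

open Classical in
/-- The law of the mark of a type-`t` particle: `m` in the class `t` is chosen with probability
`a m / classWeight a P t`. If the class has weight `0`, there are no particles of type `t`, and the
value is arbitrary. -/
def markLaw {n K : ℕ} (a : Fin n → ℝ) (P : Fin n → Fin K) (i₀ : Fin n) (t : Fin K) :
    PMF (Fin n) :=
  if h : ∑' m, markWeight a P t m = 0 then PMF.pure i₀
  else PMF.normalize (markWeight a P t) h (tsum_markWeight_ne_top a P t)

/-- The law of the marked branching process whose types are the classes of `P`. -/
def classBPLaw {n K : ℕ} (ℓ : ℝ) (A : Matrix (Fin n) (Fin n) ℝ) (a : Fin n → ℝ)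
    (P : Fin n → Fin K) (i₀ : Fin n) : Measure ((l : ℕ) → LabelledTree (Fin n) l) :=
  markedBPLaw (fun i t => (ℓ * a i * proxy A P (P i) t * classWeight a P t).toNNReal)
    (markLaw a P i₀) i₀

end RankOneKL

end

/-!
**Number of distinct rows** (after Kotlov and Lovász). Choose one row from every class, so that the
`n` rows of the symmetric `0`-`1` matrix `A` become distinct. Among all pairs of rows take one at
minimal Hamming distance, and let `D` be the set of positions where the two rows differ.

* If `#D ≥ (1 - 1 / √2) * n`, then the sign vectors of the rows span a space of dimension at most
  `rank A + 1`, and their pairwise inner products are at most a constant less than `1 / 2`. So there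
  are caps around them which cover every point boundedly often and have volume of order at least
  `2 ^ (-rank A / 2)`; hence there are only `O(2 ^ (rank A / 2))` of them.
* Otherwise delete the rows and columns in `D` and use induction on the rank. At least `n / √2` rows
  remain, and the rank drops by at least `1`. Two remaining rows can only become equal (twins) if
  they differ exactly on `D`, so no three of them do, and if there are twins, then by symmetry their
  difference is lost both as a row and as a column: the rank drops by at least `2`. If two pairs of
  twins have linearly independent differences, it drops by at least `4`. If not, Plotkin's bound
  shows that at least `#D - 4` of the remaining rows have no twin, so that `n - 4` is at most twice
  the number of distinct remaining rows.

**Branching processes.** The subtrees of the children of the root form a Poisson point process. Its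
probability generating functional, hence its law, depends on its intensity measure only; by
induction on the height, the law of the family tree depends only on the mean number of children with
mark `m` of a particle with mark `i`. Both processes have mean `ℓ * (a i * A i m * a m)`.
-/

noncomputable section

namespace RankOneKL

open scoped Finset RealInnerProductSpace

section RankDrop

variable {R V W T : Type*} [Field R]

theorem finrank_map_add_finrank_le {E F : Type*} [AddCommGroup E] [Module R E] [AddCommGroup F]
    [Module R F] (f : E →ₗ[R] F) {S L : Submodule R E} [FiniteDimensional R S]
    (hLS : L ≤ S) (hLf : L ≤ LinearMap.ker f) :
    Module.finrank R (S.map f) + Module.finrank R L ≤ Module.finrank R S := by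
  have hker : Module.finrank R L ≤ Module.finrank R (LinearMap.ker (f.domRestrict S)) := by
    rw [← (Submodule.comapSubtypeEquivOfLe hLS).finrank_eq]
    exact Submodule.finrank_mono fun x hx => hLf hx
  rw [← LinearMap.range_domRestrict, ← (f.domRestrict S).finrank_range_add_finrank_ker]
  gcongr

theorem rank_submatrix_id_add_finrank_le [Finite W] [Fintype V] [Fintype T] (M : Matrix W V R)
    (e : T → V) {L : Submodule R (V → R)} (hL : L ≤ Submodule.span R (Set.range M.row))
    (he : ∀ x ∈ L, ∀ t, x (e t) = 0) :
    (M.submatrix id e).rank + Module.finrank R L ≤ M.rank := by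
  have hspan : Submodule.span R (Set.range (M.submatrix id e).row)
      = (Submodule.span R (Set.range M.row)).map (LinearMap.funLeft R R e) := by
    rw [Submodule.map_span, ← Set.range_comp]
    rfl
  rw [Matrix.rank_eq_finrank_span_row, Matrix.rank_eq_finrank_span_row, hspan]
  exact finrank_map_add_finrank_le _ hL fun x hx => funext (he x hx)

variable [Fintype V] [Fintype T] {A : Matrix V V R}

theorem rank_submatrix_add_finrank_le (A : Matrix V V R) (e : T → V) {L : Submodule R (V → R)}
    (hL : L ≤ Submodule.span R (Set.range A.row)) (he : ∀ x ∈ L, ∀ t, x (e t) = 0) :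
    (A.submatrix e e).rank + Module.finrank R L ≤ A.rank := by
  have hrows : (A.submatrix e e).rank ≤ (A.submatrix id e).rank :=
    (A.submatrix id e).rank_submatrix_le e id
  have := rank_submatrix_id_add_finrank_le A e hL he
  omega

theorem rank_submatrix_add_two_mul_finrank_le (hA : A.IsSymm) (e : T → V)
    {L : Submodule R (V → R)} (hL : L ≤ Submodule.span R (Set.range fun t => A (e t)))
    (he : ∀ x ∈ L, ∀ t, x (e t) = 0) :
    (A.submatrix e e).rank + 2 * Module.finrank R L ≤ A.rank := by
  have hcols : (A.submatrix e e).rank + Module.finrank R L ≤ (A.submatrix e id).rank :=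
    rank_submatrix_id_add_finrank_le (A.submatrix e id) e hL he
  have htranspose : (A.submatrix e id).rank = (A.submatrix id e).rank := by
    rw [← Matrix.rank_transpose, Matrix.transpose_submatrix, hA.eq]
  have hrows := rank_submatrix_id_add_finrank_le A e
    (hL.trans (Submodule.span_mono (Set.range_comp_subset_range e A))) he
  omega

end RankDrop

section SphericalCode

variable {ι E : Type*} [NormedAddCommGroup E] [InnerProductSpace ℝ E] {x : E} {h w ρ s : ℝ}

/-- The convex cap of height `h` around the unit vector `x`. If distinct members of a family of
unit vectors have inner product at most `s`, a point lies in few of their caps of height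
`h > √s`. -/
def solidCap (x : E) (h : ℝ) : Set E :=
  {z | ‖z‖ ≤ 1 ∧ h ≤ ⟪x, z⟫}

/-- The linear map which multiplies the unit vector `x` by `w` and the orthogonal complement of `x`
by `ρ`. It maps the unit ball to an ellipsoid which, up to a translation, fits into a cap. -/
def squeeze (x : E) (w ρ : ℝ) : E →ₗ[ℝ] E :=
  ρ • LinearMap.transvection (innerSL ℝ x).toLinearMap ((w / ρ - 1) • x)

theorem det_squeeze [FiniteDimensional ℝ E] (hx : ‖x‖ = 1) :
    LinearMap.det (squeeze x w ρ) = ρ ^ Module.finrank ℝ E * (w / ρ) := by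
  rw [squeeze, LinearMap.det_smul, LinearMap.transvection.det]
  simp [hx]

theorem squeeze_apply (hρ : ρ ≠ 0) (z : E) :
    squeeze x w ρ z = ρ • (z - ⟪x, z⟫ • x) + (w * ⟪x, z⟫) • x := by
  have hscale : ρ * (⟪x, z⟫ * (w / ρ - 1)) = w * ⟪x, z⟫ - ρ * ⟪x, z⟫ := by field_simp
  simp only [squeeze, LinearMap.smul_apply, LinearMap.transvection.apply,
    ContinuousLinearMap.coe_coe, innerSL_apply_apply, smul_add, smul_smul, hscale]
  module

theorem norm_smul_add_smul_sq {y : E} (hx : ‖x‖ = 1) (hxy : ⟪x, y⟫ = 0) (ρ τ : ℝ) :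
    ‖ρ • y + τ • x‖ ^ 2 = ρ ^ 2 * ‖y‖ ^ 2 + τ ^ 2 := by
  rw [norm_add_sq_real, real_inner_smul_right, real_inner_smul_left, real_inner_comm, hxy,
    norm_smul, norm_smul, hx, mul_pow, mul_pow, Real.norm_eq_abs, Real.norm_eq_abs, sq_abs, sq_abs]
  ring

theorem image_add_image_squeeze_subset_solidCap (hx : ‖x‖ = 1) (hh : 0 ≤ h) (hw : 0 ≤ w)
    (hρ : ρ ≠ 0) (hfit : (h + 2 * w) ^ 2 + ρ ^ 2 ≤ 1) :
    (fun z => (h + w) • x + z) '' (squeeze x w ρ '' Metric.closedBall 0 1) ⊆ solidCap x h := by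
  rintro _ ⟨_, ⟨z, hz, rfl⟩, rfl⟩
  rw [mem_closedBall_zero_iff] at hz
  set τ : ℝ := ⟪x, z⟫ with hτ
  set y : E := z - τ • x with hy
  have hxx : ⟪x, x⟫ = 1 := by rw [real_inner_self_eq_norm_sq, hx, one_pow]
  have hxy : ⟪x, y⟫ = 0 := by rw [hy, inner_sub_right, real_inner_smul_right, hxx, hτ]; ring
  have hdecomp : (h + w) • x + squeeze x w ρ z = ρ • y + (h + w + w * τ) • x := by
    rw [squeeze_apply hρ, add_smul _ (w * τ)]
    abel
  have hpyth : ‖y‖ ^ 2 + τ ^ 2 ≤ 1 := by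
    have hzy : (1 : ℝ) • y + τ • x = z := by rw [hy]; module
    have := norm_smul_add_smul_sq hx hxy 1 τ
    rw [hzy] at this
    nlinarith [norm_nonneg z]
  obtain ⟨hτ₀, hτ₁⟩ : -1 ≤ τ ∧ τ ≤ 1 := abs_le.1 (abs_le_one_iff_mul_self_le_one.2 (by nlinarith))
  simp only [hdecomp]
  refine ⟨(sq_le_one_iff₀ (norm_nonneg _)).1 ?_, ?_⟩
  · have hy1 : ρ ^ 2 * ‖y‖ ^ 2 ≤ ρ ^ 2 * 1 := by gcongr; nlinarith
    have hτw : (h + w + w * τ) ^ 2 ≤ (h + 2 * w) ^ 2 :=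
      pow_le_pow_left₀ (by nlinarith) (by nlinarith) 2
    rw [norm_smul_add_smul_sq hx hxy]
    linarith
  · rw [inner_add_right, real_inner_smul_right, real_inner_smul_right, hxy, hxx]
    nlinarith

theorem isClosed_solidCap (x : E) (h : ℝ) : IsClosed (solidCap x h) :=
  (isClosed_le continuous_norm continuous_const).inter
    (isClosed_le continuous_const (innerSL ℝ x).continuous)

theorem norm_sum_sq_le {x : ι → E} (hx : ∀ i, ‖x i‖ = 1) (hs : ∀ i j, i ≠ j → ⟪x i, x j⟫ ≤ s)
    (S : Finset ι) : ‖∑ i ∈ S, x i‖ ^ 2 ≤ #S * (1 - s + s * #S) := by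
  classical
  rw [← real_inner_self_eq_norm_sq, sum_inner, ← nsmul_eq_mul, ← Finset.sum_const]
  refine Finset.sum_le_sum fun i hi => ?_
  calc ⟪x i, ∑ j ∈ S, x j⟫ = ∑ j ∈ S, ⟪x i, x j⟫ := inner_sum ..
    _ ≤ ∑ j ∈ S, ((if i = j then 1 - s else 0) + s) := by
      refine Finset.sum_le_sum fun j _ => ?_
      split_ifs with hij
      · simp [← hij, hx]
      · simpa using hs i j hij
    _ = 1 - s + s * #S := by
      rw [Finset.sum_add_distrib, Finset.sum_ite_eq, if_pos hi, Finset.sum_const, nsmul_eq_mul]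
      ring

theorem card_le_of_forall_mem_solidCap {x : ι → E} (hx : ∀ i, ‖x i‖ = 1)
    (hs : ∀ i j, i ≠ j → ⟪x i, x j⟫ ≤ s) (hs1 : s ≤ 1) (hh : 0 ≤ h) (hsh : s < h ^ 2)
    {S : Finset ι} {z : E} (hz : ∀ i ∈ S, z ∈ solidCap (x i) h) :
    (#S : ℝ) ≤ (1 - s) / (h ^ 2 - s) := by
  rw [le_div_iff₀ (by linarith)]
  rcases S.eq_empty_or_nonempty with rfl | hS
  · simpa using hs1
  obtain ⟨i₀, hi₀⟩ := hS
  have hpos : (0 : ℝ) < #S := by exact_mod_cast Finset.card_pos.2 ⟨i₀, hi₀⟩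
  have hnorm : #S * h ≤ ‖∑ i ∈ S, x i‖ :=
    calc #S * h ≤ ∑ i ∈ S, ⟪x i, z⟫ := by
          rw [← nsmul_eq_mul]
          exact Finset.card_nsmul_le_sum _ _ _ fun i hi => (hz i hi).2
      _ = ⟪∑ i ∈ S, x i, z⟫ := (sum_inner ..).symm
      _ ≤ ‖∑ i ∈ S, x i‖ * ‖z‖ := real_inner_le_norm _ _
      _ ≤ ‖∑ i ∈ S, x i‖ := mul_le_of_le_one_right (norm_nonneg _) (hz i₀ hi₀).1
  have hsq : (#S * h) ^ 2 ≤ #S * (1 - s + s * #S) :=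
    (pow_le_pow_left₀ (by positivity) hnorm 2).trans (norm_sum_sq_le hx hs S)
  have : #S * (#S * h ^ 2) ≤ #S * (1 - s + s * #S) := by linarith
  linarith [le_of_mul_le_mul_left this hpos]

end SphericalCode

theorem sum_measure_le_mul_measure {ι α : Type*} [Fintype ι] {_ : MeasurableSpace α}
    (μ : Measure α) {C : ι → Set α} {B : Set α} {k : ℝ≥0∞} (hC : ∀ i, MeasurableSet (C i))
    (hB : MeasurableSet B) (hCB : ∀ i, C i ⊆ B)
    (hk : ∀ (S : Finset ι) (z : α), (∀ i ∈ S, z ∈ C i) → #S ≤ k) :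
    ∑ i, μ (C i) ≤ k * μ B := by
  classical
  calc ∑ i, μ (C i) = ∫⁻ z, ∑ i, (C i).indicator 1 z ∂μ := by
        rw [lintegral_finsetSum _ fun i _ => measurable_one.indicator (hC i)]
        simp_rw [lintegral_indicator_one (hC _)]
    _ ≤ ∫⁻ z, B.indicator (fun _ => k) z ∂μ := by
        refine lintegral_mono fun z => ?_
        by_cases hz : z ∈ B
        · simp only [Set.indicator_of_mem hz, Set.indicator_apply, Pi.one_apply, Finset.sum_boole]
          exact hk _ z (by simp)
        · rw [Set.indicator_of_notMem hz]
          exact (Finset.sum_eq_zero fun i _ => Set.indicator_of_notMem (mt (@hCB i z) hz) _).le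
    _ = k * μ B := lintegral_indicator_const hB k

section SphericalCode

variable {ι E : Type*} [Fintype ι] [NormedAddCommGroup E] [InnerProductSpace ℝ E]
  [FiniteDimensional ℝ E] {x : ι → E} {h w ρ s : ℝ}

theorem ofReal_mul_measure_closedBall_le_measure_solidCap [MeasurableSpace E] [BorelSpace E]
    (μ : Measure E) [μ.IsAddHaarMeasure] {x : E} (hx : ‖x‖ = 1) (hh : 0 ≤ h) (hw : 0 ≤ w)
    (hρ : 0 < ρ) (hfit : (h + 2 * w) ^ 2 + ρ ^ 2 ≤ 1) :
    ENNReal.ofReal (ρ ^ Module.finrank ℝ E * (w / ρ)) * μ (Metric.closedBall 0 1)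
      ≤ μ (solidCap x h) :=
  calc _ = μ ((fun z => (h + w) • x + z) '' (squeeze x w ρ '' Metric.closedBall 0 1)) := by
        rw [Set.image_add_left, measure_preimage_add, Measure.addHaar_image_linearMap,
          det_squeeze hx, abs_of_nonneg (by positivity)]
    _ ≤ μ (solidCap x h) :=
        measure_mono (image_add_image_squeeze_subset_solidCap hx hh hw hρ.ne' hfit)

theorem card_mul_le_of_inner_le (hx : ∀ i, ‖x i‖ = 1) (hs : ∀ i j, i ≠ j → ⟪x i, x j⟫ ≤ s)
    (hs1 : s ≤ 1) (hh : 0 ≤ h) (hsh : s < h ^ 2) (hw : 0 ≤ w) (hρ : 0 < ρ)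
    (hfit : (h + 2 * w) ^ 2 + ρ ^ 2 ≤ 1) :
    Fintype.card ι * (ρ ^ Module.finrank ℝ E * (w / ρ)) ≤ (1 - s) / (h ^ 2 - s) := by
  borelize E
  let μ : Measure E := Measure.addHaar
  set v : ℝ := ρ ^ Module.finrank ℝ E * (w / ρ)
  have hk : 0 ≤ (1 - s) / (h ^ 2 - s) := div_nonneg (by linarith) (by linarith)
  have hvolume : ENNReal.ofReal (Fintype.card ι * v) * μ (Metric.closedBall 0 1)
      ≤ ENNReal.ofReal ((1 - s) / (h ^ 2 - s)) * μ (Metric.closedBall 0 1) :=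
    calc _ = Fintype.card ι • (ENNReal.ofReal v * μ (Metric.closedBall 0 1)) := by
          rw [ENNReal.ofReal_mul (by positivity), ENNReal.ofReal_natCast, nsmul_eq_mul, mul_assoc]
      _ ≤ ∑ i, μ (solidCap (x i) h) :=
          Finset.card_nsmul_le_sum _ _ _ fun i _ =>
            ofReal_mul_measure_closedBall_le_measure_solidCap μ (hx i) hh hw hρ hfit
      _ ≤ _ := by
          refine sum_measure_le_mul_measure μ (fun i => (isClosed_solidCap _ h).measurableSet)
            Metric.isClosed_closedBall.measurableSet
            (fun i z hz => mem_closedBall_zero_iff.2 hz.1) fun S z hz => ?_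
          rw [← ENNReal.ofReal_natCast]
          exact ENNReal.ofReal_le_ofReal (card_le_of_forall_mem_solidCap hx hs hs1 hh hsh hz)
  rw [ENNReal.mul_le_mul_iff_left (Metric.measure_closedBall_pos μ 0 one_pos).ne'
    measure_closedBall_lt_top.ne] at hvolume
  exact (ENNReal.ofReal_le_ofReal_iff hk).1 hvolume

end SphericalCode

theorem exists_card_le_mul_sqrt_two_pow_of_inner_le {s : ℝ} (hs : s < 1 / 2) :
    ∃ C > 0, ∀ {ι E : Type*} [Fintype ι] [NormedAddCommGroup E] [InnerProductSpace ℝ E]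
      [FiniteDimensional ℝ E] (x : ι → E), (∀ i, ‖x i‖ = 1) → (∀ i j, i ≠ j → ⟪x i, x j⟫ ≤ s) →
      Fintype.card ι ≤ C * √2 ^ Module.finrank ℝ E := by
  have hhalf : (√2 : ℝ)⁻¹ ^ 2 = 1 / 2 := by rw [inv_pow, Real.sq_sqrt zero_le_two, one_div]
  obtain ⟨h, ⟨hh, hh'⟩, hsh⟩ : ∃ h ∈ Set.Ico 0 (√2)⁻¹, s < h ^ 2 := by
    rcases lt_or_ge s 0 with hs0 | hs0
    · exact ⟨0, ⟨le_rfl, by positivity⟩, by simpa using hs0⟩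
    obtain ⟨h, hsh, hh⟩ := exists_between (Real.lt_sqrt_of_sq_lt (x := √s) (y := 1 / 2)
      (by rwa [Real.sq_sqrt hs0]))
    refine ⟨h, ⟨(Real.sqrt_nonneg s).trans hsh.le, ?_⟩, (Real.sqrt_lt' ?_).1 hsh⟩
    · simpa using hh
    · exact (Real.sqrt_nonneg s).trans_lt hsh
  set w := ((√2)⁻¹ - h) / 2 with hw
  have hw0 : 0 < w := by linarith
  have hfit : (h + 2 * w) ^ 2 + (√2)⁻¹ ^ 2 ≤ 1 := by
    rw [show h + 2 * w = (√2)⁻¹ by rw [hw]; ring, hhalf]; norm_num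
  refine ⟨(1 - s) / (h ^ 2 - s) / (w * √2), div_pos (div_pos (by linarith) (by linarith))
    (by positivity), fun {ι E} _ _ _ _ x hx hxs => ?_⟩
  calc (Fintype.card ι : ℝ)
      = Fintype.card ι * ((√2)⁻¹ ^ Module.finrank ℝ E * (w / (√2)⁻¹)) / (w * √2)
          * √2 ^ Module.finrank ℝ E := by rw [inv_pow]; field_simp
    _ ≤ _ := by
      gcongr
      exact card_mul_le_of_inner_le hx hxs (by linarith) hh hsh hw0.le (by positivity) hfit

section BinaryCode

variable {ι V : Type*} [Fintype V]

/-- The sign vector of a `0`-`1` vector, scaled to length `1`. -/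
def signVector (x : V → ℝ) : EuclideanSpace ℝ V :=
  WithLp.toLp 2 ((√(Fintype.card V))⁻¹ • (1 - (2 : ℝ) • x))

theorem signVector_apply (x : V → ℝ) (v : V) :
    signVector x v = (√(Fintype.card V))⁻¹ * (1 - 2 * x v) := rfl

theorem inner_signVector [Nonempty V] {x y : V → ℝ} (hx : ∀ v, x v = 0 ∨ x v = 1)
    (hy : ∀ v, y v = 0 ∨ y v = 1) :
    ⟪signVector x, signVector y⟫ = 1 - 2 * (hammingDist x y / Fintype.card V) := by
  classical
  have hn : (Fintype.card V : ℝ) ≠ 0 := by positivity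
  have hterm (v : V) : inner ℝ (signVector x v) (signVector y v)
      = (Fintype.card V : ℝ)⁻¹ * (1 - 2 * if x v ≠ y v then 1 else 0) := by
    have hsqrt : (√(Fintype.card V))⁻¹ * (√(Fintype.card V))⁻¹ = (Fintype.card V : ℝ)⁻¹ := by
      rw [← mul_inv, Real.mul_self_sqrt (Nat.cast_nonneg _)]
    rw [RCLike.inner_apply, conj_trivial, signVector_apply, signVector_apply, mul_mul_mul_comm,
      hsqrt]
    rcases hx v with hxv | hxv <;> rcases hy v with hyv | hyv <;> norm_num [hxv, hyv]
  have hdist : (hammingDist x y : ℝ) = ∑ v, if x v ≠ y v then 1 else 0 := by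
    rw [hammingDist, Finset.sum_boole]
  simp only [PiLp.inner_apply, hterm, hdist, ← Finset.mul_sum, Finset.sum_sub_distrib,
    Finset.sum_const, Finset.card_univ, nsmul_eq_mul, mul_one]
  field_simp

theorem norm_signVector [Nonempty V] {x : V → ℝ} (hx : ∀ v, x v = 0 ∨ x v = 1) :
    ‖signVector x‖ = 1 := by
  rw [← pow_eq_one_iff_of_nonneg (norm_nonneg _) two_ne_zero, ← real_inner_self_eq_norm_sq,
    inner_signVector hx hx]
  simp

theorem finrank_span_signVector_le [Finite ι] (M : Matrix ι V ℝ) :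
    Module.finrank ℝ (Submodule.span ℝ (Set.range fun i => signVector (M i))) ≤ M.rank + 1 := by
  let φ : (V → ℝ) ≃ₗ[ℝ] EuclideanSpace ℝ V := (WithLp.linearEquiv 2 ℝ (V → ℝ)).symm
  let rows : Submodule ℝ (V → ℝ) := Submodule.span ℝ (Set.range M.row)
  have hle : Submodule.span ℝ (Set.range fun i => signVector (M i))
      ≤ (rows ⊔ ℝ ∙ 1).map φ.toLinearMap := by
    rw [Submodule.span_le]
    rintro _ ⟨i, rfl⟩
    exact ⟨_, Submodule.smul_mem _ _ (Submodule.sub_mem _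
      (Submodule.mem_sup_right (Submodule.mem_span_singleton_self _))
      (Submodule.smul_mem _ _ (Submodule.mem_sup_left (Submodule.subset_span ⟨i, rfl⟩)))), rfl⟩
  calc _ ≤ Module.finrank ℝ ((rows ⊔ ℝ ∙ 1).map φ.toLinearMap) := Submodule.finrank_mono hle
    _ ≤ Module.finrank ℝ ↥(rows ⊔ ℝ ∙ 1) := Submodule.finrank_map_le _ _
    _ ≤ Module.finrank ℝ rows + Module.finrank ℝ (ℝ ∙ (1 : V → ℝ)) :=
      Submodule.finrank_add_le_finrank_add_finrank _ _
    _ ≤ M.rank + 1 := by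
      rw [← M.rank_eq_finrank_span_row]
      gcongr
      exact (finrank_span_le_card _).trans (by simp)

end BinaryCode

theorem exists_card_le_mul_sqrt_two_pow_rank {δ : ℝ} (hδ : 1 / 4 < δ) :
    ∃ C > 0, ∀ {ι V : Type*} [Fintype ι] [Fintype V] [Nonempty V] (M : Matrix ι V ℝ),
      (∀ i v, M i v = 0 ∨ M i v = 1) →
      (∀ i j, i ≠ j → δ * Fintype.card V ≤ hammingDist (M i) (M j)) →
      Fintype.card ι ≤ C * √2 ^ M.rank := by
  obtain ⟨C, hC, hcode⟩ := exists_card_le_mul_sqrt_two_pow_of_inner_le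
    (show 1 - 2 * δ < 1 / 2 by linarith)
  refine ⟨C * √2, by positivity, fun {ι V} _ _ _ M hM hdist => ?_⟩
  set E := Submodule.span ℝ (Set.range fun i => signVector (M i))
  let x (i : ι) : E := ⟨signVector (M i), Submodule.subset_span ⟨i, rfl⟩⟩
  have hinner (i j : ι) (hij : i ≠ j) : ⟪x i, x j⟫ ≤ 1 - 2 * δ := by
    have : δ ≤ hammingDist (M i) (M j) / Fintype.card V := by
      rw [le_div_iff₀ (by positivity)]
      exact hdist i j hij
    rw [Submodule.coe_inner, inner_signVector (hM i) (hM j)]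
    linarith
  calc (Fintype.card ι : ℝ) ≤ C * √2 ^ Module.finrank ℝ E :=
        hcode x (fun i => norm_signVector (hM i)) hinner
    _ ≤ C * √2 ^ (M.rank + 1) := by
        gcongr
        · exact Real.one_le_sqrt.2 one_le_two
        · exact finrank_span_signVector_le M
    _ = C * √2 * √2 ^ M.rank := by ring

section Plotkin

variable {ι V β : Type*} [DecidableEq β]

theorem two_mul_card_offDiag_filter_ne_le {a b : β} (S : Finset ι) {f : ι → β}
    (hf : ∀ i, f i = a ∨ f i = b) : 2 * #{p ∈ S.offDiag | f p.1 ≠ f p.2} ≤ #S ^ 2 := by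
  classical
  set P := S.filter (f · = a)
  set Q := S.filter (f · ≠ a)
  have hPQ : #P + #Q = #S := Finset.card_filter_add_card_filter_not _
  have hsub : {p ∈ S.offDiag | f p.1 ≠ f p.2} ⊆ P ×ˢ Q ∪ Q ×ˢ P := by
    rintro ⟨i, j⟩ hij
    have := hf i
    have := hf j
    grind
  have hcard : #{p ∈ S.offDiag | f p.1 ≠ f p.2} ≤ #P * #Q + #Q * #P := by
    simpa using (Finset.card_le_card hsub).trans (Finset.card_union_le _ _)
  zify at *
  nlinarith [sq_nonneg ((#P : ℤ) - #Q)]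

theorem plotkin_bound {a b : β} {x : ι → V → β} (hx : ∀ i v, x i v = a ∨ x i v = b)
    {S : Finset ι} {N : Finset V} {t : ℕ}
    (ht : ∀ i ∈ S, ∀ j ∈ S, i ≠ j → t ≤ #{v ∈ N | x i v ≠ x j v}) :
    2 * ((#S - 1) * t) ≤ #N * #S := by
  classical
  rcases S.eq_empty_or_nonempty with rfl | hS
  · simp
  refine Nat.le_of_mul_le_mul_left ?_ hS.card_pos
  calc #S * (2 * ((#S - 1) * t)) = 2 * (#S.offDiag * t) := by
        rw [Finset.offDiag_card, ← Nat.mul_sub_one]; ring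
    _ ≤ 2 * ∑ p ∈ S.offDiag, #{v ∈ N | x p.1 v ≠ x p.2 v} := by
        gcongr
        refine Finset.card_nsmul_le_sum _ _ _ fun p hp => ?_
        rw [Finset.mem_offDiag] at hp
        exact ht p.1 hp.1 p.2 hp.2.1 hp.2.2
    _ = ∑ v ∈ N, 2 * #{p ∈ S.offDiag | x p.1 v ≠ x p.2 v} := by
        rw [← Finset.mul_sum]
        congr 1
        exact Finset.sum_card_bipartiteAbove_eq_sum_card_bipartiteBelow
          fun (p : ι × ι) v => x p.1 v ≠ x p.2 v
    _ ≤ ∑ v ∈ N, #S ^ 2 := by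
        gcongr with v
        exact two_mul_card_offDiag_filter_ne_le S fun i => hx i v
    _ = #S * (#N * #S) := by rw [Finset.sum_const, smul_eq_mul]; ring

end Plotkin

section Fibers

variable {T β : Type*} [Fintype T] [DecidableEq T] [DecidableEq β]

/-- The elements which share their value under `f` with no other element. -/
def singletonFibers (f : T → β) : Finset T :=
  {u | ∀ w, f w = f u → w = u}

theorem card_add_card_singletonFibers_le {f : T → β}
    (hf : ∀ u v w, f u = f v → f u = f w → u = v ∨ u = w ∨ v = w) :
    Fintype.card T + #(singletonFibers f) ≤ 2 * #(Finset.univ.image f) := by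
  have hfiber (y : β) : #{u | f u = y} + #{u ∈ singletonFibers f | f u = y} ≤ 2 := by
    rcases Finset.eq_empty_or_nonempty {u ∈ singletonFibers f | f u = y} with hy | ⟨u, hu⟩
    · rw [hy, Finset.card_empty, add_zero]
      by_contra! hlt
      obtain ⟨u, v, w, hu, hv, hw, huv, huw, hvw⟩ := Finset.two_lt_card_iff.1 hlt
      grind
    · have hone : ({u | f u = y} : Finset T) ⊆ {u} := by grind [singletonFibers]
      have := Finset.card_le_card hone
      have := Finset.card_le_card ((Finset.filter_subset_filter (f · = y)
        (Finset.subset_univ (singletonFibers f))).trans hone)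
      simp only [Finset.card_singleton] at *
      omega
  calc Fintype.card T + #(singletonFibers f)
      = ∑ y ∈ Finset.univ.image f, (#{u | f u = y} + #{u ∈ singletonFibers f | f u = y}) := by
        rw [Finset.sum_add_distrib, ← Finset.card_univ, ← Finset.card_eq_sum_card_image,
          ← Finset.card_eq_sum_card_fiberwise]
        simp [Set.MapsTo]
    _ ≤ ∑ y ∈ Finset.univ.image f, 2 := Finset.sum_le_sum fun y _ => hfiber y
    _ = 2 * #(Finset.univ.image f) := by rw [Finset.sum_const, smul_eq_mul, mul_comm]

end Fibers

theorem injective_submatrix_rangeSplitting {V R : Type*} {A : Matrix V V R} (hA : A.IsSymm) :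
    Function.Injective
      (A.submatrix (Set.rangeSplitting A.row) (Set.rangeSplitting A.row)).row := by
  have hrep (v : V) : A (Set.rangeSplitting A.row ⟨A v, v, rfl⟩) = A v :=
    Set.apply_rangeSplitting ..
  have hcol (u v : V) : A u v = A u (Set.rangeSplitting A.row ⟨A v, v, rfl⟩) := by
    rw [← hA.apply, ← congrFun (hrep v), hA.apply]
  intro x y hxy
  refine Subtype.ext ?_
  rw [← Set.apply_rangeSplitting A.row x, ← Set.apply_rangeSplitting A.row y]
  ext v
  exact (hcol _ v).trans ((congrFun hxy _).trans (hcol _ v).symm)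

section Twins

variable {V R : Type*} {A : Matrix V V R} {D : Finset V}

/-- The principal submatrix left after deleting the rows and columns in `D`. -/
def deletion (A : Matrix V V R) (D : Finset V) : Matrix {v // v ∉ D} {v // v ∉ D} R :=
  A.submatrix (↑) (↑)

/-- Two rows are twins if they become equal when the columns in `D` are deleted. -/
def IsTwin (A : Matrix V V R) (D : Finset V) (u w : {v // v ∉ D}) : Prop :=
  u ≠ w ∧ deletion A D u = deletion A D w

variable [Fintype V] [DecidableEq R]

theorem IsTwin.apply_ne_iff {u w : {v // v ∉ D}} (huw : IsTwin A D u w)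
    (hD : ∀ u w, u ≠ w → #D ≤ hammingDist (A u) (A w)) (v : V) : A u v ≠ A w v ↔ v ∈ D := by
  have hsub : ({v | A u v ≠ A w v} : Finset V) ⊆ D := by
    intro v hv
    by_contra hvD
    exact (Finset.mem_filter.1 hv).2 (congrFun huw.2 ⟨v, hvD⟩)
  have heq := Finset.eq_of_subset_of_card_le hsub (hD u w (Subtype.coe_injective.ne huw.1))
  simp [← heq]

end Twins

/-- Symmetric matrices with entries `0` and `1`, that is, adjacency matrices of graphs in which
loops are allowed. -/
structure IsSymmBinary {V : Type*} (A : Matrix V V ℝ) : Prop where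
  isSymm : A.IsSymm
  eq_zero_or_one (u v : V) : A u v = 0 ∨ A u v = 1

theorem IsSymmBinary.submatrix {V T : Type*} {A : Matrix V V ℝ} (hA : IsSymmBinary A)
    (e : T → V) : IsSymmBinary (A.submatrix e e) :=
  ⟨hA.isSymm.submatrix e, fun _ _ => hA.eq_zero_or_one _ _⟩

theorem IsSymmBinary.sub_eq_one_or_neg_one {V : Type*} {A : Matrix V V ℝ}
    (hA : IsSymmBinary A) {u w v : V} (h : A u v ≠ A w v) :
    (A u - A w) v = 1 ∨ (A u - A w) v = -1 := by
  rcases hA.eq_zero_or_one u v with hu | hu <;> rcases hA.eq_zero_or_one w v with hw | hw <;>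
    simp_all

theorem finrank_span_pair_eq_two {V : Type*} {x y : V → ℝ} {v : V} (hx : x v = 1 ∨ x v = -1)
    (hy : y v = 1 ∨ y v = -1) (hyx : y ≠ x) (hyx' : y ≠ -x) :
    Module.finrank ℝ (Submodule.span ℝ {x, y}) = 2 := by
  have hx0 : x ≠ 0 := by rintro rfl; simp at hx
  have hli : LinearIndependent ℝ ![x, y] := by
    rw [LinearIndependent.pair_iff' hx0]
    rintro c rfl
    have hc : c = 1 ∨ c = -1 := by
      rcases hx with hx | hx <;> simp [hx] at hy <;> grind
    rcases hc with rfl | rfl <;> simp at hyx hyx'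
  rw [← Matrix.range_cons_cons_empty x y ![], finrank_span_eq_card hli, Fintype.card_fin]

section BinaryTwins

variable {V : Type*} [Fintype V] {A : Matrix V V ℝ} {D : Finset V}

theorem IsSymmBinary.not_isTwin_triple (hA : IsSymmBinary A) (hDne : D.Nonempty)
    (hD : ∀ u w, u ≠ w → #D ≤ hammingDist (A u) (A w)) (u v w : {v // v ∉ D})
    (huv : deletion A D u = deletion A D v) (huw : deletion A D u = deletion A D w) :
    u = v ∨ u = w ∨ v = w := by
  obtain ⟨d, hd⟩ := hDne
  by_contra! hne
  have h₁ := (IsTwin.apply_ne_iff ⟨hne.1, huv⟩ hD d).2 hd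
  have h₂ := (IsTwin.apply_ne_iff ⟨hne.2.1, huw⟩ hD d).2 hd
  have h₃ := (IsTwin.apply_ne_iff ⟨hne.2.2, huv.symm.trans huw⟩ hD d).2 hd
  grind [hA.eq_zero_or_one u d, hA.eq_zero_or_one v d, hA.eq_zero_or_one w d]

theorem IsSymmBinary.apply_eq_of_twin_sub_eq (hA : IsSymmBinary A)
    (hD : ∀ u w, u ≠ w → #D ≤ hammingDist (A u) (A w)) {u₀ w₀ u w : {v // v ∉ D}}
    (h₀ : IsTwin A D u₀ w₀) (huw : IsTwin A D u w)
    (hsub : A u - A w = A u₀ - A w₀ ∨ A u - A w = -(A u₀ - A w₀)) {v v' : V}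
    (hv : v ∈ D) (hv' : v' ∈ D) (hvv' : A u₀ v = A u₀ v') : A v u = A v' u := by
  have h₀ne (x : V) (hx : x ∈ D) := (h₀.apply_ne_iff hD x).2 hx
  have hne (x : V) (hx : x ∈ D) := (huw.apply_ne_iff hD x).2 hx
  rw [hA.isSymm.apply u v, hA.isSymm.apply u v']
  rcases hsub with hsub | hsub
  · have heq (x : V) (hx : x ∈ D) : A u x = A u₀ x := by
      have := congrFun hsub x
      simp only [Pi.sub_apply] at this
      grind [hA.eq_zero_or_one]
    rw [heq v hv, heq v' hv', hvv']
  · have heq (x : V) (hx : x ∈ D) : A u x = 1 - A u₀ x := by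
      have := congrFun hsub x
      simp only [Pi.sub_apply, Pi.neg_apply] at this
      grind [hA.eq_zero_or_one]
    rw [heq v hv, heq v' hv', hvv']

variable [DecidableEq V]

theorem rank_deletion_lt {a b : V} (hDne : D.Nonempty) (hab : ∀ v, A a v ≠ A b v ↔ v ∈ D) :
    (deletion A D).rank < A.rank := by
  obtain ⟨d, hd⟩ := hDne
  have hne : A a - A b ≠ 0 := fun h => (hab d).2 hd (sub_eq_zero.1 (congrFun h d))
  have hspan : ℝ ∙ (A a - A b) ≤ Submodule.span ℝ (Set.range A.row) := by
    rw [Submodule.span_singleton_le_iff_mem]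
    exact Submodule.sub_mem _ (Submodule.subset_span ⟨a, rfl⟩) (Submodule.subset_span ⟨b, rfl⟩)
  have hzero : ∀ x ∈ ℝ ∙ (A a - A b), ∀ t : {v // v ∉ D}, x t = 0 := by
    intro x hx t
    obtain ⟨c, rfl⟩ := Submodule.mem_span_singleton.1 hx
    have := not_not.1 ((hab t).not.2 t.2)
    simp [this]
  have := rank_submatrix_add_finrank_le A _ hspan hzero
  rw [finrank_span_singleton hne] at this
  exact this

theorem rank_deletion_add_two_mul_finrank_le (hA : A.IsSymm) {s : Set (V → ℝ)}
    (hs : ∀ x ∈ s, ∃ u w, IsTwin A D u w ∧ x = A u - A w) :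
    (deletion A D).rank + 2 * Module.finrank ℝ (Submodule.span ℝ s) ≤ A.rank := by
  refine rank_submatrix_add_two_mul_finrank_le hA _ (Submodule.span_le.2 fun x hx => ?_)
    fun x hx t => ?_
  · obtain ⟨u, w, -, rfl⟩ := hs x hx
    exact Submodule.sub_mem _ (Submodule.subset_span ⟨u, rfl⟩) (Submodule.subset_span ⟨w, rfl⟩)
  · have hker : Submodule.span ℝ s ≤ LinearMap.ker (LinearMap.proj (R := ℝ) t.1) := by
      refine Submodule.span_le.2 fun x hx => ?_
      obtain ⟨u, w, huw, rfl⟩ := hs x hx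
      exact sub_eq_zero.2 (congrFun huw.2 t)
    exact hker hx

theorem IsSymmBinary.rank_deletion_add_two_le (hA : IsSymmBinary A) (hDne : D.Nonempty)
    (hD : ∀ u w, u ≠ w → #D ≤ hammingDist (A u) (A w)) {u w : {v // v ∉ D}}
    (huw : IsTwin A D u w) : (deletion A D).rank + 2 ≤ A.rank := by
  obtain ⟨d, hd⟩ := hDne
  have hne : A u - A w ≠ 0 := fun h =>
    (huw.apply_ne_iff hD d).2 hd (sub_eq_zero.1 (congrFun h d))
  have := rank_deletion_add_two_mul_finrank_le hA.isSymm (D := D) (s := {A u - A w})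
    (by rintro _ rfl; exact ⟨u, w, huw, rfl⟩)
  rwa [finrank_span_singleton hne] at this

theorem IsSymmBinary.rank_deletion_add_four_le (hA : IsSymmBinary A) (hDne : D.Nonempty)
    (hD : ∀ u w, u ≠ w → #D ≤ hammingDist (A u) (A w)) {u₀ w₀ u w : {v // v ∉ D}}
    (h₀ : IsTwin A D u₀ w₀) (huw : IsTwin A D u w) (hne : A u - A w ≠ A u₀ - A w₀)
    (hne' : A u - A w ≠ -(A u₀ - A w₀)) : (deletion A D).rank + 4 ≤ A.rank := by
  obtain ⟨d, hd⟩ := hDne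
  have hdim := finrank_span_pair_eq_two
    (hA.sub_eq_one_or_neg_one ((h₀.apply_ne_iff hD d).2 hd))
    (hA.sub_eq_one_or_neg_one ((huw.apply_ne_iff hD d).2 hd)) hne hne'
  have := rank_deletion_add_two_mul_finrank_le hA.isSymm (D := D)
    (s := {A u₀ - A w₀, A u - A w})
    (by rintro _ (rfl | rfl); exacts [⟨u₀, w₀, h₀, rfl⟩, ⟨u, w, huw, rfl⟩])
  rwa [hdim] at this

theorem IsSymmBinary.card_le_card_singletonFibers_add_four (hA : IsSymmBinary A)
    (hD : ∀ u w, u ≠ w → #D ≤ hammingDist (A u) (A w)) {u₀ w₀ : {v // v ∉ D}}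
    (h₀ : IsTwin A D u₀ w₀) (hall : ∀ u w : {v // v ∉ D}, IsTwin A D u w →
      A u - A w = A u₀ - A w₀ ∨ A u - A w = -(A u₀ - A w₀)) :
    #D ≤ #(singletonFibers (deletion A D)) + 4 := by
  rcases D.eq_empty_or_nonempty with rfl | hDne
  · simp
  -- If all twins have the same difference up to sign, then two rows in `D` on which `A u₀` agrees
  -- coincide at every vertex with a twin, so they can only differ inside `N`.
  set N := (singletonFibers (deletion A D)).map (.subtype _) ∪ D with hN
  have hNcard : #N ≤ #(singletonFibers (deletion A D)) + #D :=
    (Finset.card_union_le _ _).trans_eq (by rw [Finset.card_map])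
  have hclass (c : ℝ) : 2 * ((#{v ∈ D | A u₀ v = c} - 1) * #D) ≤ #N * #{v ∈ D | A u₀ v = c} := by
    refine plotkin_bound hA.eq_zero_or_one fun v hv v' hv' hvv' => (hD v v' hvv').trans ?_
    refine Finset.card_le_card fun x hx => Finset.mem_filter.2 ⟨?_, (Finset.mem_filter.1 hx).2⟩
    rw [Finset.mem_filter] at hv hv' hx
    by_contra hxN
    simp only [hN, singletonFibers, Finset.mem_union, Finset.mem_map, Finset.mem_filter,
      Finset.mem_univ, true_and, not_or, not_exists, not_and] at hxN
    obtain ⟨w, hw, hwx⟩ : ∃ w, deletion A D w = deletion A D ⟨x, hxN.2⟩ ∧ w ≠ ⟨x, hxN.2⟩ := by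
      by_contra! h
      exact hxN.1 ⟨x, hxN.2⟩ h rfl
    have hxw : IsTwin A D ⟨x, hxN.2⟩ w := ⟨hwx.symm, hw.symm⟩
    exact hx.2 (hA.apply_eq_of_twin_sub_eq hD h₀ hxw (hall _ _ hxw) hv.1 hv'.1
      (hv.2.trans hv'.2.symm))
  have hcard : #{v ∈ D | A u₀ v = 0} + #{v ∈ D | A u₀ v = 1} = #D := by
    rw [← D.card_filter_add_card_filter_not fun v => A u₀ v = 0]
    congr 2
    exact Finset.filter_congr fun v _ => by rcases hA.eq_zero_or_one u₀ v with h | h <;> simp [h]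
  have hsum : 2 * (#{v ∈ D | A u₀ v = 0} - 1 + (#{v ∈ D | A u₀ v = 1} - 1)) ≤ #N := by
    refine Nat.le_of_mul_le_mul_right ?_ hDne.card_pos
    linarith [hclass 0, hclass 1, congrArg (#N * ·) hcard]
  omega

end BinaryTwins

section RowBound

variable {C : ℝ}

/-- The bound for the number of distinct rows of a symmetric `0`-`1` matrix of rank `r`. The
summand `-4` makes room for the `4` in the recursion `rowBound C (r + 2) = 2 * rowBound C r + 4`,
to which the deletion of twins leads. -/
def rowBound (C : ℝ) (r : ℕ) : ℝ := (C + 4) * √2 ^ r - 4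

theorem rowBound_monotone (hC : 0 ≤ C) : Monotone (rowBound C) := fun r s hrs => by
  unfold rowBound
  gcongr
  exact Real.one_le_sqrt.2 one_le_two

theorem mul_sqrt_two_pow_le_rowBound (r : ℕ) : C * √2 ^ r ≤ rowBound C r := by
  have : (1 : ℝ) ≤ √2 ^ r := one_le_pow₀ (Real.one_le_sqrt.2 one_le_two)
  unfold rowBound
  linarith

theorem sqrt_two_mul_rowBound_le (r : ℕ) : √2 * rowBound C r ≤ rowBound C (r + 1) := by
  have : (1 : ℝ) ≤ √2 := Real.one_le_sqrt.2 one_le_two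
  unfold rowBound
  rw [pow_succ]
  linarith

theorem rowBound_add_two (r : ℕ) : rowBound C (r + 2) = 2 * rowBound C r + 4 := by
  unfold rowBound
  rw [pow_add, Real.sq_sqrt zero_le_two]
  ring

end RowBound

section Induction

variable {V : Type*} [Fintype V] [DecidableEq V] {A : Matrix V V ℝ} {D : Finset V} {C : ℝ}

theorem IsSymmBinary.card_le_rowBound_of_isTwin (hA : IsSymmBinary A) (hC : 0 ≤ C)
    (hDne : D.Nonempty) (hD : ∀ u w, u ≠ w → #D ≤ hammingDist (A u) (A w))
    (hnear : Fintype.card V ≤ √2 * Fintype.card {v // v ∉ D})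
    (ih : ∀ s < A.rank, (deletion A D).rank ≤ s →
      #(Finset.univ.image (deletion A D).row) ≤ rowBound C s)
    {u₀ w₀ : {v // v ∉ D}} (h₀ : IsTwin A D u₀ w₀) : Fintype.card V ≤ rowBound C A.rank := by
  have hcount : (Fintype.card {v // v ∉ D} : ℝ) + #(singletonFibers (deletion A D))
      ≤ 2 * #(Finset.univ.image (deletion A D).row) := by
    exact_mod_cast card_add_card_singletonFibers_le (f := (deletion A D).row)
      (hA.not_isTwin_triple hDne hD)
  by_cases hall : ∀ u w : {v // v ∉ D}, IsTwin A D u w →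
      A u - A w = A u₀ - A w₀ ∨ A u - A w = -(A u₀ - A w₀)
  · have hrank := hA.rank_deletion_add_two_le hDne hD h₀
    obtain ⟨s, hs⟩ := Nat.exists_eq_add_of_le' (le_of_add_le_right hrank)
    have hDcard : (#D : ℝ) ≤ #(singletonFibers (deletion A D)) + 4 := by
      exact_mod_cast hA.card_le_card_singletonFibers_add_four hD h₀ hall
    have hV : (Fintype.card V : ℝ) = #D + Fintype.card {v // v ∉ D} := by
      rw [← Fintype.card_coe D, ← Nat.cast_add, Fintype.card_subtype_compl, Fintype.card_coe,
        Nat.add_sub_cancel' (Finset.card_le_univ D)]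
    rw [hs, rowBound_add_two]
    linarith [ih s (by omega) (by omega)]
  · push Not at hall
    obtain ⟨u, w, huw, hne, hne'⟩ := hall
    have hrank := hA.rank_deletion_add_four_le hDne hD h₀ huw hne hne'
    obtain ⟨s, hs⟩ := Nat.exists_eq_add_of_le' (le_of_add_le_right hrank)
    calc (Fintype.card V : ℝ) ≤ √2 * Fintype.card {v // v ∉ D} := hnear
      _ ≤ √2 * (2 * rowBound C s) := by
          gcongr
          linarith [ih s (by omega) (by omega),
            (Nat.cast_nonneg _ : (0 : ℝ) ≤ #(singletonFibers (deletion A D)))]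
      _ ≤ rowBound C (s + 3) := by
          rw [rowBound_add_two]
          linarith [sqrt_two_mul_rowBound_le (C := C) s]
      _ ≤ rowBound C A.rank := rowBound_monotone hC (by omega)

theorem IsSymmBinary.card_le_rowBound_of_near (hA : IsSymmBinary A) (hC : 0 ≤ C) {a b : V}
    (hDne : D.Nonempty) (hab : ∀ v, A a v ≠ A b v ↔ v ∈ D)
    (hD : ∀ u w, u ≠ w → #D ≤ hammingDist (A u) (A w))
    (hnear : Fintype.card V ≤ √2 * Fintype.card {v // v ∉ D})
    (ih : ∀ s < A.rank, (deletion A D).rank ≤ s →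
      #(Finset.univ.image (deletion A D).row) ≤ rowBound C s) :
    Fintype.card V ≤ rowBound C A.rank := by
  by_cases hinj : Function.Injective (deletion A D).row
  · have hrank := rank_deletion_lt hDne hab
    obtain ⟨s, hs⟩ := Nat.exists_eq_add_of_le' (Nat.one_le_of_lt hrank)
    have hT := ih s (by omega) (by omega)
    rw [Finset.card_image_of_injective _ hinj, Finset.card_univ] at hT
    calc (Fintype.card V : ℝ) ≤ √2 * Fintype.card {v // v ∉ D} := hnear
      _ ≤ √2 * rowBound C s := by gcongr
      _ ≤ rowBound C A.rank := hs ▸ sqrt_two_mul_rowBound_le s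
  · obtain ⟨u, w, huw, hne⟩ := Function.not_injective_iff.1 hinj
    exact hA.card_le_rowBound_of_isTwin hC hDne hD hnear ih ⟨hne, huw⟩

theorem IsSymmBinary.card_le_rowBound_of_injective (hA : IsSymmBinary A)
    (hinj : Function.Injective A.row) (hC : 0 ≤ C)
    (hfar : (∀ u w, u ≠ w → (1 - (√2)⁻¹) * Fintype.card V ≤ hammingDist (A u) (A w)) →
      Fintype.card V ≤ C * √2 ^ A.rank)
    (ih : ∀ (D : Finset V) (s : ℕ), s < A.rank → (deletion A D).rank ≤ s →
      #(Finset.univ.image (deletion A D).row) ≤ rowBound C s) :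
    Fintype.card V ≤ rowBound C A.rank := by
  by_cases hdist : ∀ u w, u ≠ w → (1 - (√2)⁻¹) * Fintype.card V ≤ hammingDist (A u) (A w)
  · exact (hfar hdist).trans (mul_sqrt_two_pow_le_rowBound _)
  push Not at hdist
  obtain ⟨u, w, huw, hlt⟩ := hdist
  obtain ⟨⟨a, b⟩, hab, hmin⟩ := (Finset.univ : Finset V).offDiag.exists_min_image
    (fun p => hammingDist (A p.1) (A p.2)) ⟨(u, w), by simpa using huw⟩
  simp only [Finset.mem_offDiag, Finset.mem_univ, true_and, Prod.forall] at hab hmin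
  set D : Finset V := {v | A a v ≠ A b v} with hDdef
  have hDcard : #D = hammingDist (A a) (A b) := rfl
  have hDV : (#D : ℝ) ≤ (1 - (√2)⁻¹) * Fintype.card V := by
    rw [hDcard]
    exact (Nat.cast_le.2 (hmin u w huw)).trans hlt.le
  refine hA.card_le_rowBound_of_near hC (a := a) (b := b) (D := D) ?_ (by simp [hDdef]) hmin ?_
    (ih D)
  · rw [← Finset.card_pos, hDcard, hammingDist_pos]
    exact hinj.ne hab
  · have : (Fintype.card {v // v ∉ D} : ℝ) = Fintype.card V - #D := by
      rw [Fintype.card_subtype_compl, Fintype.card_coe, Nat.cast_sub (Finset.card_le_univ D)]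
    have : (√2)⁻¹ * Fintype.card V ≤ Fintype.card {v // v ∉ D} := by linarith
    rwa [inv_mul_le_iff₀ (by positivity)] at this

end Induction

theorem IsSymmBinary.card_image_le_rowBound.{u} {V : Type u} [Fintype V] {A : Matrix V V ℝ}
    (hA : IsSymmBinary A) {C : ℝ} (hC : 0 ≤ C)
    (hfar : ∀ {W : Type u} [Fintype W] (B : Matrix W W ℝ), IsSymmBinary B →
      (∀ u w, u ≠ w → (1 - (√2)⁻¹) * Fintype.card W ≤ hammingDist (B u) (B w)) →
        Fintype.card W ≤ C * √2 ^ B.rank)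
    {r : ℕ} (hr : A.rank ≤ r) : #(Finset.univ.image A.row) ≤ rowBound C r := by
  classical
  induction r using Nat.strong_induction_on generalizing V with
  | _ r ih =>
    set B := A.submatrix (Set.rangeSplitting A.row) (Set.rangeSplitting A.row)
    have hB : IsSymmBinary B := hA.submatrix _
    have hBr : B.rank ≤ A.rank := A.rank_submatrix_le _ _
    have hcard : #(Finset.univ.image A.row) = Fintype.card (Set.range A.row) := by
      rw [← Set.toFinset_card, Set.toFinset_range]
    rw [hcard]
    exact (hB.card_le_rowBound_of_injective (injective_submatrix_rangeSplitting hA.isSymm) hC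
      (hfar B hB) fun D s hs hDs => ih s (by omega) (hB.submatrix _) hDs).trans
      (rowBound_monotone hC (hBr.trans hr))

theorem exists_card_image_le_mul_sqrt_two_pow_rank :
    ∃ C : ℝ, ∀ {V : Type*} [Fintype V] (A : Matrix V V ℝ), IsSymmBinary A →
      #(Finset.univ.image A.row) ≤ C * √2 ^ A.rank := by
  have hδ : 1 / 4 < 1 - (√2)⁻¹ := by
    have : (4 / 3 : ℝ) < √2 := Real.lt_sqrt_of_sq_lt (by norm_num)
    linarith [inv_strictAnti₀ (by norm_num) this]
  obtain ⟨C, hC, hcode⟩ := exists_card_le_mul_sqrt_two_pow_rank hδ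
  refine ⟨C + 4, fun A hA => ?_⟩
  calc (#(Finset.univ.image A.row) : ℝ) ≤ rowBound C A.rank := by
        refine hA.card_image_le_rowBound hC.le (fun {W} _ B hB hdist => ?_) le_rfl
        rcases isEmpty_or_nonempty W
        · rw [Fintype.card_eq_zero, Nat.cast_zero]
          positivity
        · exact hcode B hB.eq_zero_or_one hdist
    _ ≤ (C + 4) * √2 ^ A.rank := by
        unfold rowBound
        linarith

section Partition

variable {n N : ℕ} {A : Matrix (Fin n) (Fin n) ℝ}

theorem exists_isCanonicalPartition (hN : #(Finset.univ.image A.row) ≤ N) :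
    ∃ P : Fin n → Fin N, IsCanonicalPartition A P := by
  have hcard : Fintype.card (Set.range A.row) ≤ Fintype.card (Fin N) := by
    rwa [← Set.toFinset_card, Set.toFinset_range, Fintype.card_fin]
  obtain ⟨g⟩ := Function.Embedding.nonempty_of_card_le hcard
  exact ⟨fun i => g (Set.rangeFactorization A.row i), fun i j hij =>
    congrFun (congrArg Subtype.val (g.injective hij))⟩

end Partition

theorem isBigO_ceil_mul_sqrt_two_pow (C : ℝ) :
    (fun k : ℕ => ((⌈C * √2 ^ k⌉₊ : ℕ) : ℝ)) =O[Filter.atTop]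
      fun k : ℕ => (2 : ℝ) ^ ((k : ℝ) / 2) := by
  refine .of_bound (|C| + 1) (.of_forall fun k => ?_)
  have hpow : (2 : ℝ) ^ ((k : ℝ) / 2) = √2 ^ k := by
    rw [← Real.rpow_natCast, Real.sqrt_eq_rpow, ← Real.rpow_mul zero_le_two, one_div_mul_eq_div]
  have hone : (1 : ℝ) ≤ √2 ^ k := one_le_pow₀ (Real.one_le_sqrt.2 one_le_two)
  rw [hpow, Real.norm_natCast, Real.norm_of_nonneg (by positivity)]
  calc (⌈C * √2 ^ k⌉₊ : ℝ) ≤ ⌈|C| * √2 ^ k⌉₊ := by gcongr; exact le_abs_self C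
    _ ≤ |C| * √2 ^ k + 1 := (Nat.ceil_lt_add_one (by positivity)).le
    _ ≤ (|C| + 1) * √2 ^ k := by linarith

section Words

variable {α X : Type*}

/-- The function on words with the value `x` at the empty word and the values `F p` at the words
with first letter `p`. -/
def consFun (x : X) (F : α → List α → X) : List α → X
  | [] => x
  | p :: w => F p w

theorem preimage_consFun_pi (s : Set (List α)) (t : List α → Set X) [Decidable ([] ∈ s)] :
    (fun q : X × (α → List α → X) => consFun q.1 q.2) ⁻¹' s.pi t =
      (if [] ∈ s then t [] else Set.univ) ×ˢ
        {F | ∀ p w, p :: w ∈ s → F p w ∈ t (p :: w)} := by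
  ext ⟨x, F⟩
  have hwords : (consFun x F ∈ s.pi t) ↔
      ([] ∈ s → x ∈ t []) ∧ ∀ p w, p :: w ∈ s → F p w ∈ t (p :: w) :=
    ⟨fun h => ⟨h [], fun p w => h (p :: w)⟩, fun h w => by
      cases w with
      | nil => exact h.1
      | cons p w => exact h.2 p w⟩
  by_cases hs : [] ∈ s <;> simp [hwords, hs]

theorem injective_cons : Function.Injective fun q : α × List α => q.1 :: q.2 := by
  rintro ⟨a, v⟩ ⟨b, w⟩ h
  simpa using h

theorem prod_list_eq_mul_prod_preimage_cons {β : Type*} [CommMonoid β] [DecidableEq α]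
    (s : Finset (List α)) (f : List α → β) :
    ∏ w ∈ s, f w = (if [] ∈ s then f [] else 1) *
      ∏ q ∈ s.preimage (fun q : α × List α => q.1 :: q.2) injective_cons.injOn,
        f (q.1 :: q.2) := by
  classical
  rw [← Finset.prod_filter_mul_prod_filter_not s (· = []), Finset.prod_filter,
    Finset.prod_ite_eq', Finset.prod_preimage' (fun q : α × List α => q.1 :: q.2)]
  congr 2
  ext w
  cases w <;> simp

variable [MeasurableSpace X]

theorem measurable_consFun :
    Measurable fun q : X × (α → List α → X) => consFun q.1 q.2 := by
  refine measurable_pi_lambda _ fun w => ?_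
  cases w with
  | nil => exact measurable_fst
  | cons p w => exact (measurable_pi_apply w).comp ((measurable_pi_apply p).comp measurable_snd)

variable (μ : List α → Measure X) [∀ w, IsProbabilityMeasure (μ w)]

theorem infinitePi_infinitePi_cons_pi (s : Finset (List α)) {t : List α → Set X}
    (ht : ∀ w, MeasurableSet (t w)) :
    (Measure.infinitePi fun p => Measure.infinitePi fun w => μ (p :: w))
        {F | ∀ p w, p :: w ∈ (s : Set (List α)) → F p w ∈ t (p :: w)} =
      ∏ q ∈ s.preimage (fun q : α × List α => q.1 :: q.2) injective_cons.injOn,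
        μ (q.1 :: q.2) (t (q.1 :: q.2)) := by
  rw [← Measure.infinitePi_pi (fun q : α × List α => μ (q.1 :: q.2)) fun _ _ => ht _,
    ← Measure.infinitePi_map_curry_symm (fun p w => μ (p :: w)),
    Measure.map_apply (MeasurableEquiv.measurable _)
      (.pi (Finset.countable_toSet _) fun _ _ => ht _)]
  congr 1
  ext F
  simp [MeasurableEquiv.curry]

theorem map_consFun :
    ((μ []).prod (Measure.infinitePi fun p => Measure.infinitePi fun w => μ (p :: w))).map
      (fun q => consFun q.1 q.2) = Measure.infinitePi μ := by
  classical
  refine Measure.eq_infinitePi _ fun s t ht => ?_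
  rw [Measure.map_apply measurable_consFun (.pi s.countable_toSet fun w _ => ht w),
    preimage_consFun_pi, Measure.prod_prod, infinitePi_infinitePi_cons_pi μ s ht,
    prod_list_eq_mul_prod_preimage_cons s]
  congr 1
  split_ifs <;> simp_all

end Words

theorem integral_infinitePi_finset_prod {ι : Type*} {X : ι → Type*} [∀ i, MeasurableSpace (X i)]
    (μ : ∀ i, Measure (X i)) [∀ i, IsProbabilityMeasure (μ i)] (s : Finset ι) {f : ∀ i, X i → ℝ}
    (hf : ∀ i, Measurable (f i)) :
    ∫ F, ∏ i ∈ s, f i (F i) ∂(Measure.infinitePi μ) = ∏ i ∈ s, ∫ x, f i x ∂(μ i) := by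
  have hprod : Measurable fun y : ∀ i : s, X i => ∏ i : s, f i (y i) :=
    Finset.measurable_prod _ fun i _ => (hf i).comp (measurable_pi_apply i)
  simp_rw [← Finset.prod_coe_sort s]
  exact (integral_restrict_infinitePi μ hprod.aestronglyMeasurable).trans
    (integral_fintype_prod_eq_prod fun i : s => f i)

theorem integral_pow_poissonMeasure (r : ℝ≥0) (y : ℝ) :
    ∫ N, y ^ N ∂(poissonMeasure r) = Real.exp (r * (y - 1)) := by
  have hterm (N : ℕ) : (Real.exp (-r) * (r : ℝ) ^ N / N.factorial) • y ^ N =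
      Real.exp (-r) * ((r * y) ^ N / N.factorial) := by
    rw [smul_eq_mul, mul_pow]
    ring
  simp_rw [integral_poissonMeasure, hterm, tsum_mul_left]
  rw [← congrFun (NormedSpace.exp_eq_tsum_div (𝔸 := ℝ)) (r * y), ← Real.exp_eq_exp_ℝ,
    ← Real.exp_add]
  ring_nf

open BoundedContinuousFunction in
theorem ext_of_forall_mem_submonoid_integral_eq {E : Type*} [TopologicalSpace E] [PolishSpace E]
    [MeasurableSpace E] [BorelSpace E] {μ ν : Measure E} [IsFiniteMeasure μ] [IsFiniteMeasure ν]
    (S : Submonoid (E →ᵇ ℝ)) (hsep : ∀ x y, x ≠ y → ∃ f ∈ S, f x ≠ f y)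
    (h : ∀ f ∈ S, ∫ x, f x ∂μ = ∫ x, f x ∂ν) : μ = ν := by
  let A : StarSubalgebra ℝ (E →ᵇ ℝ) :=
    { Algebra.adjoin ℝ (S : Set (E →ᵇ ℝ)) with
      star_mem' := fun {f} hf => by
        rwa [show star f = f from BoundedContinuousFunction.ext fun x => star_trivial _] }
  refine ext_of_forall_mem_subalgebra_integral_eq_of_polish (𝕜 := ℝ) (A := A) ?_ fun f hf => ?_
  · intro x y hxy
    obtain ⟨f, hf, hne⟩ := hsep x y hxy
    exact ⟨f, ⟨toContinuousMapStarₐ ℝ f, ⟨f, Algebra.subset_adjoin hf, rfl⟩, rfl⟩, hne⟩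
  · have hspan : f ∈ Submodule.span ℝ (S : Set (E →ᵇ ℝ)) := by
      rwa [← Submonoid.closure_eq S, ← Algebra.adjoin_eq_span]
    clear hf
    induction hspan using Submodule.span_induction with
    | mem f hf => exact h f hf
    | zero => simp
    | add f g _ _ hf hg =>
      simp only [BoundedContinuousFunction.coe_add, Pi.add_apply]
      rw [integral_add (f.integrable μ) (g.integrable μ),
        integral_add (f.integrable ν) (g.integrable ν), hf, hg]
    | smul c f _ hf =>
      simp only [BoundedContinuousFunction.coe_smul]
      rw [integral_smul, integral_smul, hf]

section PoissonMultiset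

open unitInterval

variable {E : Type*}

theorem exists_prod_map_ne_prod_map {s t : Multiset E} (hst : s ≠ t) :
    ∃ z : E → I, (s.map z).prod ≠ (t.map z).prod := by
  classical
  obtain ⟨x, hx⟩ : ∃ x, s.count x ≠ t.count x := by
    by_contra! h
    exact hst (Multiset.ext.2 h)
  let half : I := ⟨1 / 2, by norm_num, by norm_num⟩
  let z : E → I := Function.update 1 x half
  have hz (s : Multiset E) : (s.map z).prod = half ^ s.count x := by
    rw [Multiset.prod_map_eq_pow_single x fun y hy _ => by simp [z, hy]]
    simp [z]
  refine ⟨z, fun h => hx ?_⟩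
  rw [hz, hz, Subtype.ext_iff] at h
  exact pow_right_injective₀ (by norm_num) (by norm_num) h

theorem coe_unitInterval_prod {ι : Type*} (s : Finset ι) (f : ι → I) :
    ((∏ i ∈ s, f i : I) : ℝ) = ∏ i ∈ s, (f i : ℝ) :=
  map_prod unitInterval.submonoid.subtype f s

variable {T : Type*} [Fintype T]

/-- The multiset with the points `x (t, 0), …, x (t, c t - 1)` for all `t`. -/
def scatter (q : (T → ℕ) × (T × ℕ → E)) : Multiset E :=
  ∑ t, ∑ r ∈ Finset.range (q.1 t), {q.2 (t, r)}

theorem prod_map_scatter {M : Type*} [CommMonoid M] (z : E → M)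
    (q : (T → ℕ) × (T × ℕ → E)) :
    ((scatter q).map z).prod = ∏ t, ∏ r ∈ Finset.range (q.1 t), z (q.2 (t, r)) := by
  simp only [scatter, ← Multiset.coe_mapAddMonoidHom, map_sum, Multiset.prod_sum]
  simp

theorem integral_prod_prod_range_infinitePi [MeasurableSpace E]
    (ν : T → Measure E) [∀ t, IsProbabilityMeasure (ν t)] (c : T → ℕ) {f : E → ℝ}
    (hf : Measurable f) :
    ∫ x, ∏ t, ∏ r ∈ Finset.range (c t), f (x (t, r))
        ∂(Measure.infinitePi fun p : T × ℕ => ν p.1) =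
      ∏ t, (∫ y, f y ∂(ν t)) ^ c t := by
  let s : Finset (T × ℕ) :=
    (Finset.univ.sigma fun t => Finset.range (c t)).map (Equiv.sigmaEquivProd T ℕ).toEmbedding
  have hs (g : T × ℕ → ℝ) : ∏ p ∈ s, g p = ∏ t, ∏ r ∈ Finset.range (c t), g (t, r) := by
    rw [Finset.prod_map, Finset.prod_sigma]
    rfl
  have hs' (x : T × ℕ → E) := hs fun p => f (x p)
  simp_rw [← hs']
  rw [integral_infinitePi_finset_prod (fun p : T × ℕ => ν p.1) s fun _ => hf,
    hs fun p => ∫ y, f y ∂(ν p.1)]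
  simp only [Finset.prod_const, Finset.card_range]

variable [Countable E] [MeasurableSpace (Multiset E)] [DiscreteMeasurableSpace (Multiset E)]

theorem ext_of_forall_integral_prod_map_eq {μ ν : Measure (Multiset E)} [IsFiniteMeasure μ]
    [IsFiniteMeasure ν]
    (h : ∀ z : E → I, ∫ s, ((s.map z).prod : ℝ) ∂μ = ∫ s, ((s.map z).prod : ℝ) ∂ν) : μ = ν := by
  let _ : TopologicalSpace (Multiset E) := ⊥
  have : DiscreteTopology (Multiset E) := ⟨rfl⟩
  let g (z : E → I) : BoundedContinuousFunction (Multiset E) ℝ :=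
    .ofNormedAddCommGroup (fun s => ((s.map z).prod : ℝ)) continuous_of_discreteTopology 1
      fun s => by rw [Real.norm_of_nonneg nonneg']; exact le_one'
  refine ext_of_forall_mem_submonoid_integral_eq
    { carrier := Set.range g
      one_mem' := ⟨1, by ext s; simp [g]⟩
      mul_mem' := ?_ } (fun s t hst => ?_) ?_
  · rintro _ _ ⟨z, rfl⟩ ⟨w, rfl⟩
    exact ⟨z * w, by ext s; simp [g, Multiset.prod_map_mul]⟩
  · obtain ⟨z, hz⟩ := exists_prod_map_ne_prod_map hst
    exact ⟨g z, ⟨z, rfl⟩, Subtype.coe_injective.ne hz⟩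
  · rintro _ ⟨z, rfl⟩
    exact h z

variable [MeasurableSpace E] [DiscreteMeasurableSpace E]

theorem measurable_scatter : Measurable (scatter : (T → ℕ) × (T × ℕ → E) → Multiset E) := by
  have : MeasurableAdd₂ (Multiset E) := ⟨.of_discrete⟩
  have hsing : Measurable fun x : E => ({x} : Multiset E) := .of_discrete
  refine measurable_from_prod_countable_right fun c => ?_
  exact Finset.measurable_sum _ fun t _ => Finset.measurable_sum (Finset.range (c t)) fun r _ =>
    hsing.comp (measurable_pi_apply (t, r))

/-- The law of the Poisson point process with intensity measure `∑ t, rate t • ν t`, as a random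
multiset: independently for every `t`, a Poisson number with mean `rate t` of points with law
`ν t`. -/
def poissonMultiset (rate : T → ℝ≥0) (ν : T → Measure E) : Measure (Multiset E) :=
  ((Measure.pi fun t => poissonMeasure (rate t)).prod
    (Measure.infinitePi fun p : T × ℕ => ν p.1)).map scatter

variable (rate : T → ℝ≥0) (ν : T → Measure E) [∀ t, IsProbabilityMeasure (ν t)]

instance : IsProbabilityMeasure (poissonMultiset rate ν) :=
  Measure.isProbabilityMeasure_map measurable_scatter.aemeasurable

theorem integral_prod_map_poissonMultiset (z : E → I) :
    ∫ s, ((s.map z).prod : ℝ) ∂(poissonMultiset rate ν) =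
      Real.exp (∫ x, ((z x : ℝ) - 1) ∂(∑ t, rate t • ν t)) := by
  have hz (t : T) : Integrable (fun x => (z x : ℝ)) (ν t) :=
    .of_bound Measurable.of_discrete.aestronglyMeasurable 1 (ae_of_all _ fun x => by
      rw [Real.norm_of_nonneg nonneg']; exact le_one')
  have hscatter : Integrable (fun q => (((scatter q).map z).prod : ℝ))
      ((Measure.pi fun t => poissonMeasure (rate t)).prod
        (Measure.infinitePi fun p : T × ℕ => ν p.1)) :=
    .of_bound ((Measurable.of_discrete (f := fun s : Multiset E => ((s.map z).prod : ℝ))).comp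
      measurable_scatter).aestronglyMeasurable 1 (ae_of_all _ fun x => by
        rw [Real.norm_of_nonneg nonneg']; exact le_one')
  calc ∫ s, ((s.map z).prod : ℝ) ∂(poissonMultiset rate ν)
      = ∫ c, ∫ x, ∏ t, ∏ r ∈ Finset.range (c t), (z (x (t, r)) : ℝ)
          ∂(Measure.infinitePi fun p : T × ℕ => ν p.1)
          ∂(Measure.pi fun t => poissonMeasure (rate t)) := by
        rw [poissonMultiset, integral_map measurable_scatter.aemeasurable
          Measurable.of_discrete.aestronglyMeasurable, integral_prod _ hscatter]
        simp only [prod_map_scatter, coe_unitInterval_prod]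
    _ = ∏ t, Real.exp (rate t * (∫ x, (z x : ℝ) ∂(ν t) - 1)) := by
        simp_rw [integral_prod_prod_range_infinitePi ν _
          (Measurable.of_discrete (f := fun x => (z x : ℝ))),
          ← integral_pow_poissonMeasure]
        exact integral_fintype_prod_eq_prod fun t N => (∫ x, (z x : ℝ) ∂(ν t)) ^ N
    _ = Real.exp (∫ x, ((z x : ℝ) - 1) ∂(∑ t, rate t • ν t)) := by
        have hsub (t : T) : Integrable (fun x => (z x : ℝ) - 1) (rate t • ν t) :=
          ((hz t).sub (integrable_const 1)).smul_measure_nnreal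
        rw [← Real.exp_sum, integral_finsetSum_measure fun t _ => hsub t]
        simp_rw [integral_smul_nnreal_measure, integral_sub (hz _) (integrable_const 1),
          integral_const, probReal_univ, one_smul, NNReal.smul_def, smul_eq_mul]

variable {rate ν} {T' : Type*} [Fintype T'] {rate' : T' → ℝ≥0} {ν' : T' → Measure E}
  [∀ t, IsProbabilityMeasure (ν' t)]

theorem poissonMultiset_congr (h : ∑ t, rate t • ν t = ∑ t, rate' t • ν' t) :
    poissonMultiset rate ν = poissonMultiset rate' ν' :=
  ext_of_forall_integral_prod_map_eq fun z => by
    rw [integral_prod_map_poissonMultiset, integral_prod_map_poissonMultiset, h]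

end PoissonMultiset

section FamilyTree

variable {n K : ℕ}

instance instMeasurableSpaceMultiset {α : Type} (l : ℕ) :
    MeasurableSpace (Multiset (LabelledTree α l)) := ⊤

instance instDiscreteMultiset {α : Type} (l : ℕ) :
    DiscreteMeasurableSpace (Multiset (LabelledTree α l)) := ⟨fun _ => trivial⟩

/-- The tree whose root has label `a` and the subtrees `s`. -/
def graft {α : Type} {l : ℕ} (a : α) (s : Multiset (LabelledTree α l)) :
    LabelledTree α (l + 1) := (a, s)

theorem familyTree_succ_consFun (l : ℕ) (i : Fin n) (x : Noise n K)
    (F : Fin K × ℕ → List (Fin K × ℕ) → Noise n K) :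
    familyTree (l + 1) i (consFun x F) =
      graft i (scatter (x.1 i, fun p => familyTree l ((F p []).2 p.1) (F p))) := rfl

theorem familyTree_consFun_congr (l : ℕ) (i : Fin n) (c : Fin n → Fin K → ℕ)
    (d d' : Fin K → Fin n) (F : Fin K × ℕ → List (Fin K × ℕ) → Noise n K) :
    familyTree l i (consFun (c, d) F) = familyTree l i (consFun (c, d') F) := by
  cases l <;> rfl

theorem measurable_familyTree_mark (l : ℕ) (t : Fin K) :
    Measurable fun ω : List (Fin K × ℕ) → Noise n K => familyTree l ((ω []).2 t) ω := by
  have hjoint : Measurable fun p : (List (Fin K × ℕ) → Noise n K) × Fin n =>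
      familyTree l p.2 p.1 := measurable_from_prod_countable_left (measurable_familyTree l)
  have hmark : Measurable fun ω : List (Fin K × ℕ) → Noise n K => (ω []).2 t := by fun_prop
  exact hjoint.comp (measurable_id.prodMk hmark)

variable (rate : Fin n → Fin K → ℝ≥0) (mark : Fin K → PMF (Fin n))

/-- The joint law of the independent noises of all potential particles. -/
def envLaw : Measure (List (Fin K × ℕ) → Noise n K) :=
  Measure.infinitePi fun _ => noiseLaw rate mark

/-- The law of the family tree up to generation `l` of a particle with mark `i`. -/
def treeLaw (l : ℕ) (i : Fin n) : Measure (LabelledTree (Fin n) l) :=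
  (envLaw rate mark).map (familyTree l i)

instance : IsProbabilityMeasure (envLaw rate mark) := by
  unfold envLaw; infer_instance

instance (l : ℕ) (i : Fin n) : IsProbabilityMeasure (treeLaw rate mark l i) :=
  Measure.isProbabilityMeasure_map (measurable_familyTree l i).aemeasurable

/-- The mean number of children with mark `m` of a particle with mark `i`. -/
def meanOffspring (i m : Fin n) : ℝ≥0∞ := ∑ t, rate i t * mark t m

theorem map_consFun_envLaw :
    ((noiseLaw rate mark).prod (Measure.infinitePi fun _ => envLaw rate mark)).map
      (fun q => consFun q.1 q.2) = envLaw rate mark :=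
  map_consFun fun _ => noiseLaw rate mark

theorem lintegral_envLaw {f : (List (Fin K × ℕ) → Noise n K) → ℝ≥0∞} (hf : Measurable f) :
    ∫⁻ ω, f ω ∂(envLaw rate mark) =
      ∫⁻ d, ∫⁻ c, ∫⁻ F, f (consFun (c, d) F) ∂(Measure.infinitePi fun _ => envLaw rate mark)
        ∂(Measure.pi fun i => Measure.pi fun t => poissonMeasure (rate i t))
        ∂(Measure.pi fun t => (mark t).toMeasure) := by
  have hcons : Measurable fun q : Noise n K × (Fin K × ℕ → List (Fin K × ℕ) → Noise n K) =>
      f (consFun q.1 q.2) := hf.comp measurable_consFun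
  nth_rw 1 [← map_consFun_envLaw]
  rw [lintegral_map hf measurable_consFun, lintegral_prod _ hcons.aemeasurable, noiseLaw,
    lintegral_prod_symm _ hcons.lintegral_prod_right'.aemeasurable]

/-- The law of the family tree up to generation `l` of a particle of type `t`. -/
def childLaw (l : ℕ) (t : Fin K) : Measure (LabelledTree (Fin n) l) :=
  (envLaw rate mark).map fun ω => familyTree l ((ω []).2 t) ω

instance (l : ℕ) (t : Fin K) : IsProbabilityMeasure (childLaw rate mark l t) :=
  Measure.isProbabilityMeasure_map (measurable_familyTree_mark l t).aemeasurable

theorem childLaw_eq_sum (l : ℕ) (t : Fin K) :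
    childLaw rate mark l t = ∑ m, mark t m • treeLaw rate mark l m := by
  -- The tree of a particle does not depend on the marks which its own noise holds in store for it,
  -- so these may be replaced by the constant `d₀` once they have provided the label of the root.
  let d₀ (s : Fin K) : Fin n := (mark s).support_nonempty.some
  refine Measure.ext_of_lintegral _ fun f hf => ?_
  let h (m : Fin n) : ℝ≥0∞ := ∫⁻ c, ∫⁻ F, f (familyTree l m (consFun (c, d₀) F))
    ∂(Measure.infinitePi fun _ : Fin K × ℕ => envLaw rate mark)
    ∂(Measure.pi fun i => Measure.pi fun t => poissonMeasure (rate i t))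
  have htree (m : Fin n) : ∫⁻ T, f T ∂(treeLaw rate mark l m) = h m := by
    rw [treeLaw, lintegral_map hf (measurable_familyTree l m),
      lintegral_envLaw rate mark (f := fun ω => f (familyTree l m ω))
        (hf.comp (measurable_familyTree l m))]
    simp_rw [familyTree_consFun_congr l m _ _ d₀]
    rw [lintegral_const, measure_univ, mul_one]
  calc ∫⁻ T, f T ∂((envLaw rate mark).map fun ω => familyTree l ((ω []).2 t) ω)
      = ∫⁻ d, h (d t) ∂(Measure.pi fun t => (mark t).toMeasure) := by
        rw [lintegral_map hf (measurable_familyTree_mark l t),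
          lintegral_envLaw rate mark (f := fun ω => f (familyTree l ((ω []).2 t) ω))
            (hf.comp (measurable_familyTree_mark l t))]
        exact lintegral_congr fun d => lintegral_congr fun c => lintegral_congr fun F =>
          congrArg f (familyTree_consFun_congr l (d t) c d d₀ F)
    _ = ∫⁻ m, h m ∂(mark t).toMeasure :=
        (measurePreserving_eval (fun t => (mark t).toMeasure) t).lintegral_comp .of_discrete
    _ = ∫⁻ T, f T ∂(∑ m, mark t m • treeLaw rate mark l m) := by
        simp_rw [lintegral_finsetSum_measure, lintegral_smul_measure, htree, lintegral_fintype,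
          PMF.toMeasure_apply_singleton _ _ (measurableSet_singleton _), smul_eq_mul, mul_comm]

theorem treeLaw_succ (l : ℕ) (i : Fin n) :
    treeLaw rate mark (l + 1) i =
      (poissonMultiset (rate i) (childLaw rate mark l)).map (graft i) := by
  have hcount : MeasurePreserving (fun x : Noise n K => x.1 i) (noiseLaw rate mark)
      (Measure.pi fun t => poissonMeasure (rate i t)) :=
    (measurePreserving_eval _ i).comp measurePreserving_fst
  have hforest : MeasurePreserving
      (fun (F : Fin K × ℕ → List (Fin K × ℕ) → Noise n K) p => familyTree l ((F p []).2 p.1) (F p))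
      (Measure.infinitePi fun _ => envLaw rate mark)
      (Measure.infinitePi fun p : Fin K × ℕ => childLaw rate mark l p.1) :=
    ⟨measurable_pi_lambda _ fun p =>
      (measurable_familyTree_mark l p.1).comp (measurable_pi_apply p),
      Measure.infinitePi_map_pi (f := fun p ω => familyTree l ((ω []).2 p.1) ω) _
        fun p : Fin K × ℕ => measurable_familyTree_mark l p.1⟩
  have hgraft : Measurable (graft i : _ → LabelledTree (Fin n) (l + 1)) := .of_discrete
  rw [treeLaw, ← map_consFun_envLaw,
    Measure.map_map (measurable_familyTree (l + 1) i) measurable_consFun, poissonMultiset,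
    ← (hcount.prod hforest).map_eq, Measure.map_map hgraft measurable_scatter,
    Measure.map_map (hgraft.comp measurable_scatter) (hcount.prod hforest).measurable]
  exact congrArg (Measure.map · _) (funext fun q => familyTree_succ_consFun l i q.1 q.2)

theorem sum_rate_smul_childLaw (l : ℕ) (i : Fin n) :
    ∑ t, rate i t • childLaw rate mark l t =
      ∑ m, meanOffspring rate mark i m • treeLaw rate mark l m := by
  simp_rw [childLaw_eq_sum, meanOffspring, Finset.sum_smul, Finset.smul_sum, ENNReal.smul_def,
    smul_smul]
  exact Finset.sum_comm

variable {rate mark} {K' : ℕ} {rate' : Fin n → Fin K' → ℝ≥0} {mark' : Fin K' → PMF (Fin n)}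

theorem treeLaw_congr (h : meanOffspring rate mark = meanOffspring rate' mark') (l : ℕ) :
    treeLaw rate mark l = treeLaw rate' mark' l := by
  induction l with
  | zero =>
    ext1 i
    exact (Measure.map_const _ _).trans (by
      rw [measure_univ, ← measure_univ (μ := envLaw rate' mark')]
      exact (Measure.map_const _ _).symm)
  | succ l ih =>
    ext1 i
    have hintensity : ∑ t, rate i t • childLaw rate mark l t =
        ∑ t, rate' i t • childLaw rate' mark' l t := by
      rw [sum_rate_smul_childLaw, sum_rate_smul_childLaw, h, ih]
    rw [treeLaw_succ, treeLaw_succ, poissonMultiset_congr hintensity]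

/-- Forgetting the last generation. -/
def truncate {α : Type} : (l : ℕ) → LabelledTree α (l + 1) → LabelledTree α l
  | 0, T => T.1
  | l + 1, T => (T.1, Multiset.map (truncate l) T.2)

theorem truncate_familyTree (l : ℕ) (i : Fin n) (ω : List (Fin K × ℕ) → Noise n K) :
    truncate l (familyTree (l + 1) i ω) = familyTree l i ω := by
  induction l generalizing i ω with
  | zero => rfl
  | succ l ih =>
    refine Prod.ext rfl ?_
    change Multiset.mapAddMonoidHom (truncate l) (∑ t : Fin K, ∑ r ∈ Finset.range ((ω []).1 i t),
      {familyTree (l + 1) ((ω [(t, r)]).2 t) fun w => ω ((t, r) :: w)}) = _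
    simp only [map_sum, Multiset.coe_mapAddMonoidHom, Multiset.map_singleton, ih]
    rfl

theorem exists_truncation (n : ℕ) {l L : ℕ} (h : l ≤ L) :
    ∃ g : LabelledTree (Fin n) L → LabelledTree (Fin n) l, ∀ (K : ℕ) (i : Fin n)
      (ω : List (Fin K × ℕ) → Noise n K), g (familyTree L i ω) = familyTree l i ω := by
  induction L, h using Nat.le_induction with
  | base => exact ⟨id, fun _ _ _ => rfl⟩
  | succ L _ ih =>
    obtain ⟨g, hg⟩ := ih
    exact ⟨g ∘ truncate L, fun K i ω => by
      rw [Function.comp_apply, truncate_familyTree, hg]⟩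

theorem exists_map_restrict_markedBPLaw_eq_map_treeLaw (I : Finset ℕ) :
    ∃ g : LabelledTree (Fin n) (I.sup id) → ∀ l : I, LabelledTree (Fin n) l,
      ∀ {K : ℕ} (rate : Fin n → Fin K → ℝ≥0) (mark : Fin K → PMF (Fin n)) (i₀ : Fin n),
        (markedBPLaw rate mark i₀).map I.restrict =
          (treeLaw rate mark (I.sup id) i₀).map g := by
  choose g hg using fun l : I => exists_truncation n (Finset.le_sup (f := id) l.2)
  refine ⟨fun T l => g l T, fun {K} rate mark i₀ => ?_⟩
  rw [markedBPLaw, treeLaw, envLaw, Measure.map_map (Finset.measurable_restrict I)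
      (measurable_pi_lambda _ fun l => measurable_familyTree l i₀),
    Measure.map_map .of_discrete (measurable_familyTree _ i₀)]
  congr 1
  ext ω l
  exact (hg l K i₀ ω).symm

theorem markedBPLaw_congr (h : meanOffspring rate mark = meanOffspring rate' mark') :
    markedBPLaw rate mark = markedBPLaw rate' mark' := by
  ext1 i₀
  refine IsProjectiveLimit.unique (P := fun I => (markedBPLaw rate mark i₀).map I.restrict)
    (fun I => rfl) fun I => ?_
  obtain ⟨g, hg⟩ := exists_map_restrict_markedBPLaw_eq_map_treeLaw (n := n) I
  change (markedBPLaw rate' mark' i₀).map I.restrict = (markedBPLaw rate mark i₀).map I.restrict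
  rw [hg, hg, treeLaw_congr h]

end FamilyTree

section CanonicalPartition

variable {n K : ℕ} {A : Matrix (Fin n) (Fin n) ℝ} {P : Fin n → Fin K} {a : Fin n → ℝ} {ℓ : ℝ}

theorem proxy_apply_apply (hA : IsSymmBinary A) (hP : IsCanonicalPartition A P) (i m : Fin n) :
    proxy A P (P i) (P m) = A i m := by
  have hcongr (i' m' : Fin n) (hi : P i' = P i) (hm : P m' = P m) : A i' m' = A i m := by
    rw [hP i' i hi m', ← hA.isSymm.apply, hP m' m hm i, hA.isSymm.apply]
  unfold proxy
  split_ifs with h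
  · exact (h i m rfl rfl).symm
  · refine ((hA.eq_zero_or_one i m).resolve_right fun h1 => h fun i' m' hi hm => ?_).symm
    rw [hcongr i' m' hi hm, h1]

theorem proxy_nonneg (A : Matrix (Fin n) (Fin n) ℝ) (P : Fin n → Fin K) (s t : Fin K) :
    0 ≤ proxy A P s t := by
  unfold proxy
  split_ifs <;> norm_num

theorem tsum_markWeight (ha : ∀ i, 0 ≤ a i) (P : Fin n → Fin K) (t : Fin K) :
    ∑' m, markWeight a P t m = ENNReal.ofReal (classWeight a P t) := by
  rw [tsum_fintype, classWeight, ENNReal.ofReal_sum_of_nonneg fun m _ => ha m, Finset.sum_filter]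
  rfl

theorem ofReal_classWeight_mul_markLaw (ha : ∀ i, 0 ≤ a i) (P : Fin n → Fin K) (i₀ : Fin n)
    (t : Fin K) (m : Fin n) :
    ENNReal.ofReal (classWeight a P t) * markLaw a P i₀ t m = markWeight a P t m := by
  rw [← tsum_markWeight ha, markLaw]
  split_ifs with h
  · rw [h, zero_mul, ENNReal.tsum_eq_zero.1 h m]
  · rw [PMF.normalize_apply, mul_left_comm, ENNReal.mul_inv_cancel h (tsum_markWeight_ne_top a P t),
      mul_one]

theorem meanOffspring_markLaw (hA : IsSymmBinary A) (hP : IsCanonicalPartition A P)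
    (ha : ∀ i, 0 ≤ a i) (hℓ : 0 ≤ ℓ) (i₀ i m : Fin n) :
    meanOffspring (fun i t => (ℓ * a i * proxy A P (P i) t * classWeight a P t).toNNReal)
      (markLaw a P i₀) i m = ENNReal.ofReal (ℓ * (a i * A i m * a m)) := by
  have hrate (t : Fin K) : 0 ≤ ℓ * a i * proxy A P (P i) t :=
    mul_nonneg (mul_nonneg hℓ (ha i)) (proxy_nonneg A P _ _)
  have hterm (t : Fin K) :
      ((ℓ * a i * proxy A P (P i) t * classWeight a P t).toNNReal : ℝ≥0∞) * markLaw a P i₀ t m =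
        if P m = t then ENNReal.ofReal (ℓ * (a i * A i m * a m)) else 0 := by
    rw [← ENNReal.ofReal, ENNReal.ofReal_mul (hrate t), mul_assoc,
      ofReal_classWeight_mul_markLaw ha, markWeight]
    split_ifs with h
    · rw [← ENNReal.ofReal_mul (hrate t), ← h, proxy_apply_apply hA hP]
      ring_nf
    · exact mul_zero _
  simp only [meanOffspring, hterm, Finset.sum_ite_eq, Finset.mem_univ, if_true]

theorem meanOffspring_pure (rate : Fin n → Fin n → ℝ≥0) (i m : Fin n) :
    meanOffspring rate PMF.pure i m = rate i m := by
  simp [meanOffspring, PMF.pure_apply]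

theorem classBPLaw_eq_nTypeBPLaw (hA : IsSymmBinary A) (hP : IsCanonicalPartition A P)
    (ha : ∀ i, 0 ≤ a i) (hℓ : 0 ≤ ℓ) (i₀ : Fin n) :
    classBPLaw ℓ A a P i₀ = nTypeBPLaw ℓ (Matrix.diagonal a * A * Matrix.diagonal a) i₀ := by
  refine congrFun (markedBPLaw_congr ?_) i₀
  ext1 i
  ext1 m
  rw [meanOffspring_markLaw hA hP ha hℓ, meanOffspring_pure, Matrix.mul_diagonal,
    Matrix.diagonal_mul]
  rfl

end CanonicalPartition

end RankOneKL

end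

theorem mainTheorem6_general :
    ∃ f : ℕ → ℕ,
      (fun k : ℕ => (f k : ℝ)) =O[Filter.atTop] (fun k : ℕ => (2 : ℝ) ^ ((k : ℝ) / 2)) ∧
      ∀ (n k : ℕ) (A : Matrix (Fin n) (Fin n) ℝ), A.IsSymm →
        (∀ i j, A i j = 0 ∨ A i j = 1) → A.rank = k →
        (∃ P : Fin n → Fin (f k), RankOneKL.IsCanonicalPartition A P) ∧
        ∀ (K : ℕ) (P : Fin n → Fin K), RankOneKL.IsCanonicalPartition A P →
          ∀ (a : Fin n → ℝ), (∀ i, 0 ≤ a i) → ∀ (ℓ : ℝ), 0 ≤ ℓ → ∀ (i₀ : Fin n),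
            RankOneKL.classBPLaw ℓ A a P i₀ =
              RankOneKL.nTypeBPLaw ℓ (Matrix.diagonal a * A * Matrix.diagonal a) i₀ := by
  obtain ⟨C, hC⟩ := RankOneKL.exists_card_image_le_mul_sqrt_two_pow_rank
  refine ⟨fun k => ⌈C * √2 ^ k⌉₊, RankOneKL.isBigO_ceil_mul_sqrt_two_pow C,
    fun n k A hsymm hbin hrank => ?_⟩
  have hA : RankOneKL.IsSymmBinary A := ⟨hsymm, hbin⟩
  have hrows : Finset.card (Finset.univ.image A.row) ≤ ⌈C * √2 ^ k⌉₊ :=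
    Nat.cast_le.1 (((hC A hA).trans_eq (by rw [hrank])).trans (Nat.le_ceil _))
  exact ⟨RankOneKL.exists_isCanonicalPartition hrows, fun K P hP a ha ℓ hℓ i₀ =>
    RankOneKL.classBPLaw_eq_nTypeBPLaw hA hP ha hℓ i₀⟩

theorem mainTheorem6 :
    ∃ f : ℕ → ℕ,
      (fun k : ℕ => (f k : ℝ)) =O[Filter.atTop] (fun k : ℕ => (2 : ℝ) ^ ((k : ℝ) / 2)) ∧
      ∀ (n k : ℕ) (A : Matrix (Fin n) (Fin n) ℝ), A.IsSymm →
        (∀ i j, A i j = 0 ∨ A i j = 1) → (∀ i, A i i = 0) → A.rank = k →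
        (∃ P : Fin n → Fin (f k), RankOneKL.IsCanonicalPartition A P) ∧
        ∀ (K : ℕ) (P : Fin n → Fin K), RankOneKL.IsCanonicalPartition A P →
          ∀ (a : Fin n → ℝ), (∀ i, 0 ≤ a i) → ∀ (ℓ : ℝ), 0 ≤ ℓ → ∀ (i₀ : Fin n),
            RankOneKL.classBPLaw ℓ A a P i₀ =
              RankOneKL.nTypeBPLaw ℓ (Matrix.diagonal a * A * Matrix.diagonal a) i₀ := by
  obtain ⟨f, hf, h⟩ := mainTheorem6_general
  exact ⟨f, hf, fun n k A hsymm hbin _ hrank => h n k A hsymm hbin hrank⟩
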